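/- Let $k$ be an algebraically closed field and let $n\ge 2$. All indices $i,u$ are taken in $\mathbb Z/n\mathbb Z$. Let $Q_n$ be the quiver with vertices $(i,u)\in\mathbb Z/n\mathbb Z\times\mathbb Z/n\mathbb Z$ and arrows $$a_{i,u}:(i-1,u)\to(i,u)\quad (u\neq i-1),\qquad b_{i,u}:(i,u-1)\to(i,u)\quad (u\neq i).$$ In the path algebra $kQ_n$ paths are composed from left to right. Let $\Gamma=\Gamma_{\Lambda_n}$ (the Auslander algebra of the Taft algebra $\Lambda_n$) be the quotient of $kQ_n$ by the two-sided ideal generated by the mesh relations $a_{i,i-2}\,b_{i,i-1}=0$ for all $i$, and $a_{i,u-1}b_{i,u}+b_{i-1,u}a_{i,u}=0$ for all $(i,u)$ with $u\ne i$ and $u\neq i-1$. Write $e_{i,u}\in\Gamma$ for the idempotent at the vertex $(i,u)$ and $\otimes=\otimes_k$, and put $$R_0=\bigoplus_{(i,u)}\Gamma e_{i,u}\otimes e_{i,u}\Gamma,\qquad R_1=\bigoplus_{\substack{(i,u)\\ u\ne i-1}}\Gamma e_{i-1,u}\otimes e_{i,u}\Gamma\ \oplus\ \bigoplus_{\substack{(i,u)\\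 u\neq i}}\Gamma e_{i,u-1}\otimes e_{i,u}\Gamma,$$ $$R_2=\bigoplus_{\substack{(i,u)\\ i\neq u}}\Gamma e_{i-1,u-1}\otimes e_{i,u}\Gamma .$$ Then $R_2\neq 0$, and there are homomorphisms of $\Gamma$-bimodules such that $$0\to R_2\to R_1\to R_0\to\Gamma\to 0$$ is a minimal projective resolution of $\Gamma$ as a $\Gamma$-bimodule: the sequence is exact, the $R_p$ are projective $\Gamma$-bimodules (i.e. projective modules over $\Gamma\otimes\Gamma^{\mathrm{op}}$), and the kernel of each of the maps starting at $R_0$, $R_1$, $R_2$ is a superfluous sub-bimodule (a sub-bimodule $N\subseteq R$ is superfluous if $N+L=R$ implies $L=R$ for every sub-bimodule $L$). -/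

import Mathlib

open scoped TensorProduct DirectSum

noncomputable section

/-! ## Path algebras -/

/-- The underlying vector space of the path algebra `kQ` of a quiver `Q` with vertex set `V`:
the `k`-vector space with basis the set of all (directed) paths of `Q`. -/
def PathAlgebra (k : Type*) [Field k] (V : Type*) [Quiver V] :=
  (Σ a b : V, Quiver.Path a b) →₀ k

namespace PathAlgebra

variable {k : Type*} [Field k] {V : Type*} [Quiver V]

instance : AddCommGroup (PathAlgebra k V) :=
  inferInstanceAs (AddCommGroup ((Σ a b : V, Quiver.Path a b) →₀ k))

instance : Module k (PathAlgebra k V) :=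
  inferInstanceAs (Module k ((Σ a b : V, Quiver.Path a b) →₀ k))

/-- A path, as a basis element of the path algebra. -/
def ofPath {a b : V} (p : Quiver.Path a b) : PathAlgebra k V :=
  Finsupp.single ⟨a, b, p⟩ 1

open Classical in
/-- The product of two basis elements: the concatenation "first `p`, then `q`" if `p` ends where
`q` starts, and zero otherwise. -/
def mulPath (p q : Σ a b : V, Quiver.Path a b) : PathAlgebra k V :=
  if h : q.1 = p.2.1 then ofPath (p.2.2.comp (q.2.2.cast h rfl)) else 0

/-- The linear map with given values on the basis of paths. -/
def lift {M : Type*} [AddCommGroup M] [Module k M] (f : (Σ a b : V, Quiver.Path a b) → M) :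
    PathAlgebra k V →ₗ[k] M :=
  Finsupp.linearCombination k f

theorem lift_ofPath {M : Type*} [AddCommGroup M] [Module k M]
    (f : (Σ a b : V, Quiver.Path a b) → M) {a b : V} (p : Quiver.Path a b) :
    lift f (ofPath p : PathAlgebra k V) = f ⟨a, b, p⟩ :=
  (Finsupp.linearCombination_single k (1 : k) _).trans (one_smul k _)

/-- The bilinear extension of the product of paths. -/
def mulHom : PathAlgebra k V →ₗ[k] PathAlgebra k V →ₗ[k] PathAlgebra k V :=
  lift fun p => lift fun q => mulPath p q

instance : Mul (PathAlgebra k V) := ⟨fun x y => mulHom x y⟩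

theorem mul_def (x y : PathAlgebra k V) : x * y = mulHom x y := rfl

theorem ofPath_mul_ofPath {a b c : V} (p : Quiver.Path a b) (q : Quiver.Path b c) :
    (ofPath p * ofPath q : PathAlgebra k V) = ofPath (p.comp q) := by
  rw [mul_def, mulHom, lift_ofPath, lift_ofPath]
  simp [mulPath]

theorem ofPath_mul_ofPath_of_ne {a b c d : V} (p : Quiver.Path a b) (q : Quiver.Path c d)
    (h : c ≠ b) : (ofPath p * ofPath q : PathAlgebra k V) = 0 := by
  rw [mul_def, mulHom, lift_ofPath, lift_ofPath]
  simp [mulPath, h]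

theorem induction_on {P : PathAlgebra k V → Prop} (x : PathAlgebra k V) (h0 : P 0)
    (hadd : ∀ x y, P x → P y → P (x + y))
    (hpath : ∀ (r : k) (a b : V) (p : Quiver.Path a b), P (r • ofPath p)) : P x := by
  refine Finsupp.induction_linear x h0 hadd ?_
  rintro ⟨a, b, p⟩ r
  have h : (r • ofPath p : PathAlgebra k V) = Finsupp.single ⟨a, b, p⟩ r :=
    Finsupp.smul_single_one _ r
  exact h ▸ hpath r a b p

protected theorem add_mul (x y z : PathAlgebra k V) : (x + y) * z = x * z + y * z := by
  simp [mul_def]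

protected theorem mul_add (x y z : PathAlgebra k V) : x * (y + z) = x * y + x * z := by
  simp [mul_def]

protected theorem zero_mul (x : PathAlgebra k V) : 0 * x = 0 := by
  simp [mul_def]

protected theorem mul_zero (x : PathAlgebra k V) : x * 0 = 0 := by
  simp [mul_def]

protected theorem smul_mul (r : k) (x y : PathAlgebra k V) : (r • x) * y = r • (x * y) := by
  simp [mul_def]

protected theorem mul_smul (r : k) (x y : PathAlgebra k V) : x * (r • y) = r • (x * y) := by
  simp [mul_def]

protected theorem mul_assoc (x y z : PathAlgebra k V) : x * y * z = x * (y * z) := by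
  induction x using induction_on with
  | h0 => simp only [PathAlgebra.zero_mul]
  | hadd x x' hx hx' => simp only [PathAlgebra.add_mul, hx, hx']
  | hpath r a b p =>
    induction y using induction_on with
    | h0 => simp only [PathAlgebra.zero_mul, PathAlgebra.mul_zero]
    | hadd y y' hy hy' => simp only [PathAlgebra.add_mul, PathAlgebra.mul_add, hy, hy']
    | hpath s c d q =>
      induction z using induction_on with
      | h0 => simp only [PathAlgebra.mul_zero]
      | hadd z z' hz hz' => simp only [PathAlgebra.mul_add, hz, hz']
      | hpath t e f w =>
        simp only [PathAlgebra.smul_mul, PathAlgebra.mul_smul]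
        congr 3
        by_cases h1 : c = b
        · subst h1
          rw [ofPath_mul_ofPath]
          by_cases h2 : e = d
          · subst h2
            rw [ofPath_mul_ofPath, ofPath_mul_ofPath, ofPath_mul_ofPath, Quiver.Path.comp_assoc]
          · rw [ofPath_mul_ofPath_of_ne _ _ h2, ofPath_mul_ofPath_of_ne _ _ h2,
              PathAlgebra.mul_zero]
        · rw [ofPath_mul_ofPath_of_ne _ _ h1, PathAlgebra.zero_mul]
          by_cases h2 : e = d
          · subst h2
            rw [ofPath_mul_ofPath, ofPath_mul_ofPath_of_ne _ _ h1]
          · rw [ofPath_mul_ofPath_of_ne _ _ h2, PathAlgebra.mul_zero]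

variable [Fintype V]

/-- The unit of the path algebra of a quiver with finitely many vertices is the sum of the
trivial paths. -/
instance : One (PathAlgebra k V) := ⟨∑ v : V, ofPath (Quiver.Path.nil : Quiver.Path v v)⟩

theorem one_def : (1 : PathAlgebra k V) = ∑ v : V, ofPath (Quiver.Path.nil : Quiver.Path v v) :=
  rfl

protected theorem one_mul (x : PathAlgebra k V) : 1 * x = x := by
  induction x using induction_on with
  | h0 => rw [PathAlgebra.mul_zero]
  | hadd x y hx hy => rw [PathAlgebra.mul_add, hx, hy]
  | hpath r a b p =>
    rw [PathAlgebra.mul_smul, one_def, mul_def, map_sum, LinearMap.sum_apply,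
      Finset.sum_eq_single a]
    · rw [← mul_def, ofPath_mul_ofPath, Quiver.Path.nil_comp]
    · intro c _ hc
      rw [← mul_def, ofPath_mul_ofPath_of_ne _ _ (Ne.symm hc)]
    · simp

protected theorem mul_one (x : PathAlgebra k V) : x * 1 = x := by
  induction x using induction_on with
  | h0 => rw [PathAlgebra.zero_mul]
  | hadd x y hx hy => rw [PathAlgebra.add_mul, hx, hy]
  | hpath r a b p =>
    rw [PathAlgebra.smul_mul, one_def, mul_def, map_sum, Finset.sum_eq_single b]
    · rw [← mul_def, ofPath_mul_ofPath, Quiver.Path.comp_nil]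
    · intro c _ hc
      rw [← mul_def, ofPath_mul_ofPath_of_ne _ _ hc]
    · simp

instance : Ring (PathAlgebra k V) :=
  { (inferInstance : AddCommGroup (PathAlgebra k V)),
    (inferInstance : Mul (PathAlgebra k V)),
    (inferInstance : One (PathAlgebra k V)) with
    left_distrib := PathAlgebra.mul_add
    right_distrib := PathAlgebra.add_mul
    zero_mul := PathAlgebra.zero_mul
    mul_zero := PathAlgebra.mul_zero
    mul_assoc := PathAlgebra.mul_assoc
    one_mul := PathAlgebra.one_mul
    mul_one := PathAlgebra.mul_one }

instance : Algebra k (PathAlgebra k V) :=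
  Algebra.ofModule PathAlgebra.smul_mul (fun r x y => PathAlgebra.mul_smul r x y)

end PathAlgebra

/-! ## Bimodules and minimal projective resolutions -/

section Bimodules

variable (k : Type*) [Field k] (A : Type*) [Ring A] [Algebra k A]

/-- The enveloping algebra of `A`; its left modules are the `A`-bimodules (with `k` acting
centrally). -/
abbrev EnvelopingAlgebra := A ⊗[k] Aᵐᵒᵖ

/-- `A` as an `A`-bimodule: `(x ⊗ y) • m = x * m * y`. -/
instance envelopingAlgebraModuleSelf : Module (EnvelopingAlgebra k A) A :=
  instModuleTensorProductMop k A

variable {A}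

/-- The `k`-vector space `A e ⊗ₖ f A`, where `A e` is the left ideal generated by `e` and
`f A` is the right ideal generated by `f`. -/
def OuterBimodule (e f : A) :=
  (Submodule.span A {e}) ⊗[k] (Submodule.span Aᵐᵒᵖ {f})

namespace OuterBimodule

variable (e f : A)

instance : AddCommGroup (OuterBimodule k e f) :=
  inferInstanceAs (AddCommGroup ((Submodule.span A {e}) ⊗[k] (Submodule.span Aᵐᵒᵖ {f})))

instance : Module k (OuterBimodule k e f) :=
  inferInstanceAs (Module k ((Submodule.span A {e}) ⊗[k] (Submodule.span Aᵐᵒᵖ {f})))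

/-- The action of the enveloping algebra on `A e ⊗ₖ f A`:
`x ⊗ y` acts by `m ⊗ n ↦ (x * m) ⊗ (n * y)`. -/
def action : EnvelopingAlgebra k A →ₐ[k]
    Module.End k ((Submodule.span A {e}) ⊗[k] (Submodule.span Aᵐᵒᵖ {f})) :=
  (Module.endTensorEndAlgHom (R := k) (S := k) (A := k)).comp
    (Algebra.TensorProduct.map (Algebra.lsmul k k (Submodule.span A {e}))
      (Algebra.lsmul k k (Submodule.span Aᵐᵒᵖ {f})))

/-- The outer bimodule structure on `A e ⊗ₖ f A`. -/
instance : Module (EnvelopingAlgebra k A) (OuterBimodule k e f) :=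
  Module.compHom ((Submodule.span A {e}) ⊗[k] (Submodule.span Aᵐᵒᵖ {f}))
    (action k e f).toRingHom

/-- The pure tensor `m ⊗ n` in `A e ⊗ₖ f A`. -/
def tmul (m : Submodule.span A {e}) (n : Submodule.span Aᵐᵒᵖ {f}) : OuterBimodule k e f :=
  m ⊗ₜ[k] n

theorem smul_tmul (x : A) (y : Aᵐᵒᵖ) (m : Submodule.span A {e}) (n : Submodule.span Aᵐᵒᵖ {f}) :
    (x ⊗ₜ[k] y : EnvelopingAlgebra k A) • tmul k e f m n = tmul k e f (x • m) (y • n) :=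
  rfl

end OuterBimodule

end Bimodules

/-- A submodule `N` of `M` is superfluous if `N + L = M` forces `L = M`. -/
def Submodule.IsSuperfluous {R M : Type*} [Ring R] [AddCommGroup M] [Module R M]
    (N : Submodule R M) : Prop :=
  ∀ L : Submodule R M, N ⊔ L = ⊤ → L = ⊤

/-- `0 → R₂ → R₁ → R₀ → M → 0` is a minimal projective resolution of the `R`-module `M`: it is
exact, the `Rᵢ` are projective, and each of them is a projective cover of its image, that is, the
kernel of each of the maps `ε`, `d₁`, `d₂` is superfluous. -/
structure IsMinimalProjectiveResolution {R M R₀ R₁ R₂ : Type*} [Ring R]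
    [AddCommGroup M] [Module R M] [AddCommGroup R₀] [Module R R₀] [AddCommGroup R₁] [Module R R₁]
    [AddCommGroup R₂] [Module R R₂]
    (d₂ : R₂ →ₗ[R] R₁) (d₁ : R₁ →ₗ[R] R₀) (ε : R₀ →ₗ[R] M) : Prop where
  projective_zero : Module.Projective R R₀
  projective_one : Module.Projective R R₁
  projective_two : Module.Projective R R₂
  injective : Function.Injective d₂
  exact_one : Function.Exact d₂ d₁
  exact_zero : Function.Exact d₁ ε
  surjective : Function.Surjective ε
  minimal_zero : ε.ker.IsSuperfluous
  minimal_one : d₁.ker.IsSuperfluous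
  minimal_two : d₂.ker.IsSuperfluous

/-! ## The quiver with relations of the Auslander algebra of the Taft algebra -/

namespace TaftAuslander

/-- The vertices of the quiver `Q_n` are indexed by `(i, u)` in `ℤ/n × ℤ/n`. -/
def Vertex (n : ℕ) := ZMod n × ZMod n

instance (n : ℕ) [NeZero n] : Fintype (Vertex n) := inferInstanceAs (Fintype (ZMod n × ZMod n))

/-- The vertex `(i, u)`. -/
def vtx {n : ℕ} (i u : ZMod n) : Vertex n := (i, u)

/-- The arrows of `Q_n`: `a_{i,u} : (i-1, u) → (i, u)` for `u ≠ i - 1`, and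
`b_{i,u} : (i, u-1) → (i, u)` for `u ≠ i`. -/
inductive Arrow (n : ℕ) : Vertex n → Vertex n → Type
  | a (i u : ZMod n) (h : u ≠ i - 1) : Arrow n (vtx (i - 1) u) (vtx i u)
  | b (i u : ZMod n) (h : u ≠ i) : Arrow n (vtx i (u - 1)) (vtx i u)

instance (n : ℕ) : Quiver (Vertex n) := ⟨Arrow n⟩

section

variable (k : Type*) [Field k] {n : ℕ}

/-- The arrow `a_{i,u}` as an element of the path algebra. -/
def pa (i u : ZMod n) (h : u ≠ i - 1) : PathAlgebra k (Vertex n) :=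
  PathAlgebra.ofPath (Quiver.Hom.toPath (Arrow.a i u h : vtx (i - 1) u ⟶ vtx i u))

/-- The arrow `b_{i,u}` as an element of the path algebra. -/
def pb (i u : ZMod n) (h : u ≠ i) : PathAlgebra k (Vertex n) :=
  PathAlgebra.ofPath (Quiver.Hom.toPath (Arrow.b i u h : vtx i (u - 1) ⟶ vtx i u))

variable (n)

/-- The mesh relations: `a_{i,i-2} b_{i,i-1} = 0` for all `i`, and
`a_{i,u-1} b_{i,u} + b_{i-1,u} a_{i,u} = 0` for all squares, i.e. for all `i`, `u` for which the
four arrows exist. -/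
inductive MeshRel : PathAlgebra k (Vertex n) → PathAlgebra k (Vertex n) → Prop
  | triangle (i : ZMod n) (ha : i - 2 ≠ i - 1) (hb : i - 1 ≠ i) :
      MeshRel (pa k i (i - 2) ha * pb k i (i - 1) hb) 0
  | square (i u : ZMod n) (ha : u - 1 ≠ i - 1) (hb : u ≠ i) (hb' : u ≠ i - 1)
      (ha' : u ≠ i - 1) :
      MeshRel (pa k i (u - 1) ha * pb k i u hb + pb k (i - 1) u hb' * pa k i u ha') 0

variable [NeZero n]

/-- The algebra `Γ`: the quotient of the path algebra `k Q_n` by the two-sided ideal generated by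
the mesh relations. -/
abbrev Gam := RingQuot (MeshRel k n)

variable {n}

/-- The idempotent `e_{i,u}` of `Γ`. -/
def idem (i u : ZMod n) : Gam k n :=
  RingQuot.mkAlgHom k (MeshRel k n)
    (PathAlgebra.ofPath (Quiver.Path.nil : Quiver.Path (vtx i u) (vtx i u)))

/-- The `Γ`-bimodule `Γ e_{j,v} ⊗ₖ e_{i,u} Γ`. -/
abbrev ProjBimod (j v i u : ZMod n) := OuterBimodule k (idem k j v) (idem k i u)

variable (n)

/-- `R₀ = ⨁_{(i,u)} Γ e_{i,u} ⊗ e_{i,u} Γ`. -/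
abbrev R₀ := ⨁ x : ZMod n × ZMod n, ProjBimod k x.1 x.2 x.1 x.2

/-- `R₁ = ⨁_{(i,u), u ≠ i-1} Γ e_{i-1,u} ⊗ e_{i,u} Γ ⊕ ⨁_{(i,u), u ≠ i} Γ e_{i,u-1} ⊗ e_{i,u} Γ`;
the summands correspond to the arrows `a_{i,u}` and `b_{i,u}` of the quiver. -/
abbrev R₁ :=
  (⨁ x : {x : ZMod n × ZMod n // x.2 ≠ x.1 - 1},
      ProjBimod k (x.1.1 - 1) x.1.2 x.1.1 x.1.2) ×
  (⨁ x : {x : ZMod n × ZMod n // x.2 ≠ x.1},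
      ProjBimod k x.1.1 (x.1.2 - 1) x.1.1 x.1.2)

/-- `R₂ = ⨁_{(i,u), i ≠ u} Γ e_{i-1,u-1} ⊗ e_{i,u} Γ`. -/
abbrev R₂ :=
  ⨁ x : {x : ZMod n × ZMod n // x.1 ≠ x.2},
    ProjBimod k (x.1.1 - 1) (x.1.2 - 1) x.1.1 x.1.2

end

end TaftAuslander

end

/-! The differentials are the usual ones for a quiver with relations: `ε` multiplies, `d₁` sends the
generator of an arrow `α` to `e ⊗ α - α ⊗ e`, and `d₂` sends the generator of a mesh to the
derivative of its relation, the sum over the arrows in it of the relation with that arrow replaced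
by its generator. Everything rests on a normal form in `Γ`.

The mesh relations move every arrow `a` to the right of every arrow `b`, up to sign. So `Γ` is
spanned by the words `b ⋯ b a ⋯ a`, determined by the starting vertex and the numbers `s`, `t` of
arrows (`lenSpan_zero`). Call `(u - i).val` the height of `(i, u)`: an arrow `b` raises it by one
and is missing at height `n - 1`, an arrow `a` lowers it by one and is missing at height `0`.
`Valid` says that the word never runs through a missing arrow; the other words vanish
(`word_eq_zero`). The valid words are linearly independent because the rewriting rules define a
representation of `Γ` on formal words (`exists_rep`, `exists_coord`).

Exactness comes from a contracting homotopy that is linear only on the left, so that it may be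
prescribed freely on right multiples of generators by valid words. In degree 0 it differentiates a
word letter by letter (`wordDeriv`). In degree 1 it kills the generators of the arrows `b`, since
`b` times a word is already a word, and on a generator of an arrow `a` it records the meshes crossed
while `a` moves past the arrows `b` (`meshDeriv`). The identities reduce to `d₁_wordDeriv` and
`d₂_meshDeriv`; they are assembled in `exists_homotopy`.

Minimality is a Nakayama argument. Word length gives a multiplicative filtration that vanishes from
degree `2 * n` on, and the images of `d₁` and `d₂` lie in the part of positive total degree
(`isSuperfluous_of_le_radGen`). -/

open scoped TensorProduct DirectSum

noncomputable section

/-! ### Left and right actions on bimodules. -/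

section BimoduleActions

variable (k : Type*) [Field k] {A : Type*} [Ring A] [Algebra k A]
  {M : Type*} [AddCommGroup M] [Module (EnvelopingAlgebra k A) M]
  {N : Type*} [AddCommGroup N] [Module (EnvelopingAlgebra k A) N]

/-- The left action of `A` on an `A`-bimodule. -/
def lact : A →+ M →+ M :=
  (smulAddHom (EnvelopingAlgebra k A) M).comp
    ((TensorProduct.mk k A Aᵐᵒᵖ).flip 1).toAddMonoidHom

/-- The right action of `A` on an `A`-bimodule. -/
def ract : A →+ M →+ M :=
  (smulAddHom (EnvelopingAlgebra k A) M).comp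
    (((TensorProduct.mk k A Aᵐᵒᵖ) 1).toAddMonoidHom.comp
      (MulOpposite.opAddEquiv : A ≃+ Aᵐᵒᵖ).toAddMonoidHom)

theorem lact_def (x : A) (m : M) :
    lact k x m = (x ⊗ₜ[k] (1 : Aᵐᵒᵖ) : EnvelopingAlgebra k A) • m := rfl

theorem ract_def (y : A) (m : M) :
    ract k y m = ((1 : A) ⊗ₜ[k] MulOpposite.op y : EnvelopingAlgebra k A) • m := rfl

theorem lact_mul (x y : A) (m : M) : lact k (x * y) m = lact k x (lact k y m) := by
  simp [lact_def, smul_smul]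

theorem ract_mul (x y : A) (m : M) : ract k (x * y) m = ract k y (ract k x m) := by
  simp [ract_def, smul_smul]

theorem lact_one (m : M) : lact k (1 : A) m = m := by
  rw [lact_def, ← Algebra.TensorProduct.one_def, one_smul]

theorem ract_one (m : M) : ract k (1 : A) m = m := by
  rw [ract_def, MulOpposite.op_one, ← Algebra.TensorProduct.one_def, one_smul]

theorem ract_lact (x y : A) (m : M) : ract k y (lact k x m) = lact k x (ract k y m) := by
  simp [lact_def, ract_def, smul_smul]

theorem tmul_smul_eq (x y : A) (m : M) :
    (x ⊗ₜ[k] MulOpposite.op y : EnvelopingAlgebra k A) • m = lact k x (ract k y m) := by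
  simp [lact_def, ract_def, smul_smul]

theorem lact_smul (c : k) (x : A) (m : M) :
    lact k (c • x) m = algebraMap k (EnvelopingAlgebra k A) c • lact k x m := by
  rw [lact_def, lact_def, smul_smul, ← Algebra.smul_def, TensorProduct.smul_tmul']

theorem ract_smul (c : k) (x : A) (m : M) :
    ract k (c • x) m = algebraMap k (EnvelopingAlgebra k A) c • ract k x m := by
  rw [ract_def, ract_def, smul_smul, ← Algebra.smul_def, MulOpposite.op_smul,
    TensorProduct.tmul_smul]

theorem lact_algebraMap (c : k) (x : A) (m : M) :
    lact k x (algebraMap k (EnvelopingAlgebra k A) c • m) = lact k (c • x) m := by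
  rw [lact_smul, lact_def, lact_def, smul_smul, smul_smul, Algebra.commutes]

theorem map_lact (φ : M →ₗ[EnvelopingAlgebra k A] N) (x : A) (m : M) :
    φ (lact k x m) = lact k x (φ m) := by
  simp [lact_def]

theorem map_ract (φ : M →ₗ[EnvelopingAlgebra k A] N) (x : A) (m : M) :
    φ (ract k x m) = ract k x (φ m) := by
  simp [ract_def]

theorem lact_mem (L : Submodule (EnvelopingAlgebra k A) M) (x : A) {m : M} (h : m ∈ L) :
    lact k x m ∈ L :=
  L.smul_mem _ h

theorem ract_mem (L : Submodule (EnvelopingAlgebra k A) M) (x : A) {m : M} (h : m ∈ L) :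
    ract k x m ∈ L :=
  L.smul_mem _ h

theorem lact_self (x y : A) : lact k x y = x * y := by
  rw [lact_def]
  change x • ((1 : Aᵐᵒᵖ) • y) = x * y
  rw [one_smul, smul_eq_mul]

theorem ract_self (x y : A) : ract k x y = y * x := by
  rw [ract_def]
  exact one_smul A (y * x)

end BimoduleActions

/-! ### The bimodules `A e ⊗ f A`: maps out of them and projectivity. -/

namespace OuterBimodule

variable (k : Type*) [Field k] {A : Type*} [Ring A] [Algebra k A] (e f : A)
  {M : Type*} [AddCommGroup M] [Module (EnvelopingAlgebra k A) M]

/-- The generator `e ⊗ f` of `A e ⊗ f A`. -/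
def gen : OuterBimodule k e f :=
  tmul k e f ⟨e, Submodule.mem_span_singleton_self e⟩ ⟨f, Submodule.mem_span_singleton_self f⟩

theorem lact_ract_gen (p q : A) : lact k p (ract k q (gen k e f)) =
    tmul k e f ⟨p * e, Submodule.mem_span_singleton.2 ⟨p, rfl⟩⟩
      ⟨f * q, Submodule.mem_span_singleton.2 ⟨MulOpposite.op q, rfl⟩⟩ := by
  rw [← tmul_smul_eq]
  rfl

/-- Induction on the additive group `A e ⊗ f A`. -/
theorem mem_of_gen (S : AddSubgroup (OuterBimodule k e f))
    (h : ∀ p q : A, lact k p (ract k q (gen k e f)) ∈ S) (m : OuterBimodule k e f) : m ∈ S := by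
  have key : ∀ m : (Submodule.span A {e}) ⊗[k] (Submodule.span Aᵐᵒᵖ {f}),
      (show OuterBimodule k e f from m) ∈ S := by
    intro m
    induction m with
    | zero => exact S.zero_mem
    | add x y hx hy => exact S.add_mem hx hy
    | tmul x y =>
      obtain ⟨x, hx⟩ := x
      obtain ⟨y, hy⟩ := y
      obtain ⟨p, rfl⟩ := Submodule.mem_span_singleton.1 hx
      obtain ⟨q, rfl⟩ := Submodule.mem_span_singleton.1 hy
      have := h p q.unop
      rw [lact_ract_gen] at this
      exact this
  exact key m

/-- The map `A e ⊗ f A → M`, `p ⊗ q ↦ p H(q)`. -/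
def liftLeft (H : A →+ M)
    (hH : ∀ (c : k) (q : A), H (c • q) = algebraMap k (EnvelopingAlgebra k A) c • H q) :
    OuterBimodule k e f →+ M :=
  TensorProduct.liftAddHom (R := k) (M := Submodule.span A {e}) (N := Submodule.span Aᵐᵒᵖ {f})
    (AddMonoidHom.mk' (fun p => ((lact k (p : A)).comp H).comp
        (Submodule.span Aᵐᵒᵖ {f}).subtype.toAddMonoidHom)
      (by intro p q; ext x; simp))
    (by
      intro c p q
      have h1 : ((c • p : Submodule.span A {e}) : A) = c • (p : A) := rfl
      have h2 : ((c • q : Submodule.span Aᵐᵒᵖ {f}) : A) = c • (q : A) := rfl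
      change lact k ((c • p : Submodule.span A {e}) : A) (H q) =
        lact k (p : A) (H ((c • q : Submodule.span Aᵐᵒᵖ {f}) : A))
      rw [h1, h2, hH, lact_algebraMap])

variable {e f}

theorem liftLeft_apply (H : A →+ M)
    (hH : ∀ (c : k) (q : A), H (c • q) = algebraMap k (EnvelopingAlgebra k A) c • H q) (p q : A) :
    liftLeft k e f H hH (lact k p (ract k q (gen k e f))) = lact k (p * e) (H (f * q)) := by
  rw [lact_ract_gen]
  rfl

/-- For `m = e m f`, the bimodule map `A e ⊗ f A → M` with `e ⊗ f ↦ m`. -/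
theorem exists_lift (m : M) (he : lact k e m = m) (hf : ract k f m = m) :
    ∃ φ : OuterBimodule k e f →ₗ[EnvelopingAlgebra k A] M, φ (gen k e f) = m := by
  let H : A →+ M := (ract k (M := M)).flip m
  have hH : ∀ (c : k) (q : A), H (c • q) = algebraMap k (EnvelopingAlgebra k A) c • H q :=
    fun c q => ract_smul k c q m
  have hφ : ∀ p q : A, liftLeft k e f H hH (lact k p (ract k q (gen k e f))) =
      lact k p (ract k q m) := by
    intro p q
    rw [liftLeft_apply]
    simp only [H, AddMonoidHom.flip_apply]
    rw [ract_mul, hf, lact_mul, ← ract_lact k e, he]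
  refine ⟨{ liftLeft k e f H hH with map_smul' := ?_ }, ?_⟩
  · intro r z
    simp only [ZeroHom.toFun_eq_coe, AddMonoidHom.toZeroHom_coe, RingHom.id_apply]
    have key : ∀ (x : A) (y : Aᵐᵒᵖ), liftLeft k e f H hH
        ((x ⊗ₜ[k] y : EnvelopingAlgebra k A) • z) =
          (x ⊗ₜ[k] y : EnvelopingAlgebra k A) • liftLeft k e f H hH z := by
      intro x y
      obtain ⟨y, rfl⟩ := MulOpposite.op_surjective y
      rw [tmul_smul_eq, tmul_smul_eq]
      let S : AddSubgroup (OuterBimodule k e f) := AddMonoidHom.eqLocus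
        ((liftLeft k e f H hH).comp ((lact k x).comp (ract k y)))
        (((lact k x).comp (ract k y)).comp (liftLeft k e f H hH))
      refine mem_of_gen k e f S (fun p q => ?_) z
      change liftLeft k e f H hH (lact k x (ract k y (lact k p (ract k q (gen k e f))))) =
        lact k x (ract k y (liftLeft k e f H hH (lact k p (ract k q (gen k e f)))))
      rw [ract_lact, ← ract_mul, ← lact_mul, hφ, hφ, ract_lact, ← ract_mul, ← lact_mul]
    induction r using TensorProduct.induction_on with
    | zero => simpa only [TensorProduct.zero_tmul] using key 0 0
    | add x y hx hy => rw [add_smul, add_smul, map_add, hx, hy]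
    | tmul x y => exact key x y
  · have := hφ 1 1
    rw [lact_one, ract_one, lact_one, ract_one] at this
    exact this

/-- Over a field there are functionals not vanishing at `e` and at `f`; their tensor product does
not vanish at `e ⊗ f`. -/
theorem gen_ne_zero (he : e ≠ 0) (hf : f ≠ 0) : gen k e f ≠ 0 := by
  intro h
  have he' : (⟨e, Submodule.mem_span_singleton_self e⟩ : Submodule.span A {e}) ≠ 0 :=
    fun h => he (congrArg Subtype.val h)
  have hf' : (⟨f, Submodule.mem_span_singleton_self f⟩ : Submodule.span Aᵐᵒᵖ {f}) ≠ 0 :=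
    fun h => hf (congrArg Subtype.val h)
  obtain ⟨φ, hφ⟩ := not_forall.1 fun h => he' ((Module.forall_dual_apply_eq_zero_iff k _).1 h)
  obtain ⟨ψ, hψ⟩ := not_forall.1 fun h => hf' ((Module.forall_dual_apply_eq_zero_iff k _).1 h)
  have := congrArg (TensorProduct.dualDistrib k _ _ (φ ⊗ₜ ψ)) h
  refine mul_ne_zero hφ hψ (this.trans ?_)
  exact map_zero (TensorProduct.dualDistrib k _ _ (φ ⊗ₜ[k] ψ))

theorem lact_gen (he : e * e = e) : lact k e (gen k e f) = gen k e f := by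
  have := lact_ract_gen k e f e 1
  rw [ract_one] at this
  rw [this]
  simp [gen, he]

theorem ract_gen (hf : f * f = f) : ract k f (gen k e f) = gen k e f := by
  have := lact_ract_gen k e f 1 f
  rw [lact_one] at this
  rw [this]
  simp [gen, hf]

/-- The bimodule is a retract of the free module of rank one: `e ⊗ f` goes to the idempotent `e ⊗ op
f`, and acting on the generator goes back. -/
theorem projective (he : e * e = e) (hf : f * f = f) :
    Module.Projective (EnvelopingAlgebra k A) (OuterBimodule k e f) := by
  obtain ⟨φ, hφ⟩ := exists_lift k (e := e) (f := f)
    (e ⊗ₜ[k] MulOpposite.op f : EnvelopingAlgebra k A)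
    (by simp [lact_def, he]) (by simp [ract_def, ← MulOpposite.op_mul, hf])
  refine Module.Projective.of_split φ
    (LinearMap.toSpanSingleton (EnvelopingAlgebra k A) _ (gen k e f)) ?_
  ext z
  let S : AddSubgroup (OuterBimodule k e f) := AddMonoidHom.eqLocus
    ((LinearMap.toSpanSingleton (EnvelopingAlgebra k A) _ (gen k e f)).comp φ).toAddMonoidHom
    (AddMonoidHom.id _)
  refine mem_of_gen k e f S (fun p q => ?_) z
  change φ (lact k p (ract k q (gen k e f))) • gen k e f = lact k p (ract k q (gen k e f))
  rw [map_lact, map_ract, hφ, lact_def, ract_def, smul_eq_mul, smul_eq_mul, mul_smul, mul_smul,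
    tmul_smul_eq k e f, ract_gen k hf, lact_gen k he, ← ract_def, ← lact_def]

end OuterBimodule

/-! ### Direct sums of the bimodules `A e ⊗ f A`. -/

section OuterSum

variable (k : Type*) [Field k] {A : Type*} [Ring A] [Algebra k A] {X : Type*} [DecidableEq X]
  (e f : X → A) {M : Type*} [AddCommGroup M] [Module (EnvelopingAlgebra k A) M]

/-- The generator `e x ⊗ f x` of `⨁ x, A (e x) ⊗ (f x) A`. -/
def sumGen (x : X) : ⨁ x, OuterBimodule k (e x) (f x) :=
  DirectSum.lof (EnvelopingAlgebra k A) X (fun x => OuterBimodule k (e x) (f x)) x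
    (OuterBimodule.gen k (e x) (f x))

theorem sumGen_ne_zero (x : X) (he : e x ≠ 0) (hf : f x ≠ 0) : sumGen k e f x ≠ 0 := by
  intro h
  refine OuterBimodule.gen_ne_zero k he hf
    (DirectSum.of_injective (β := fun x => OuterBimodule k (e x) (f x)) x ?_)
  rw [map_zero]
  exact h

theorem mem_of_sumGen (S : AddSubgroup (⨁ x, OuterBimodule k (e x) (f x)))
    (h : ∀ x (p q : A), lact k p (ract k q (sumGen k e f x)) ∈ S)
    (m : ⨁ x, OuterBimodule k (e x) (f x)) : m ∈ S := by
  induction m using DirectSum.induction_on with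
  | zero => exact S.zero_mem
  | add x y hx hy => exact S.add_mem hx hy
  | of x m =>
    refine OuterBimodule.mem_of_gen k (e x) (f x)
      (S.comap (DirectSum.of (fun x => OuterBimodule k (e x) (f x)) x)) (fun p q => ?_) m
    have := h x p q
    rw [sumGen, ← map_ract, ← map_lact] at this
    exact this

variable {e f}

/-- The homotopy is not right linear, so maps are needed that are linear only on the left. Such a
map is free to take any `k`-linear values on the right factor; the factor `e x` on the value
reflects that the left factor is `A (e x)` and not `A`. -/
theorem exists_sum_liftLeft (H : X → A →+ M)
    (hH : ∀ x (c : k) (q : A), H x (c • q) = algebraMap k (EnvelopingAlgebra k A) c • H x q) :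
    ∃ φ : (⨁ x, OuterBimodule k (e x) (f x)) →+ M,
      (∀ (p : A) m, φ (lact k p m) = lact k p (φ m)) ∧
      ∀ x (q : A), φ (ract k q (sumGen k e f x)) = lact k (e x) (H x (f x * q)) := by
  let φ : (⨁ x, OuterBimodule k (e x) (f x)) →+ M :=
    DirectSum.toAddMonoid fun x => OuterBimodule.liftLeft k (e x) (f x) (H x) (hH x)
  have hφ : ∀ x (p q : A), φ (lact k p (ract k q (sumGen k e f x))) =
      lact k (p * e x) (H x (f x * q)) := by
    intro x p q
    rw [sumGen, ← map_ract, ← map_lact]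
    exact (DirectSum.toAddMonoid_of _ _ _).trans
      (OuterBimodule.liftLeft_apply k (H x) (hH x) p q)
  refine ⟨φ, fun p m => ?_, fun x q => ?_⟩
  · refine mem_of_sumGen k e f (AddMonoidHom.eqLocus (φ.comp (lact k p)) ((lact k p).comp φ))
      (fun x p' q => ?_) m
    change φ (lact k p (lact k p' (ract k q (sumGen k e f x)))) =
      lact k p (φ (lact k p' (ract k q (sumGen k e f x))))
    rw [← lact_mul, hφ, hφ, ← lact_mul, mul_assoc]
  · have := hφ x 1 q
    rwa [lact_one, one_mul] at this

theorem exists_sum_lift (m : X → M) (he : ∀ x, lact k (e x) (m x) = m x)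
    (hf : ∀ x, ract k (f x) (m x) = m x) :
    ∃ φ : (⨁ x, OuterBimodule k (e x) (f x)) →ₗ[EnvelopingAlgebra k A] M,
      ∀ x, φ (sumGen k e f x) = m x := by
  choose φ hφ using fun x => OuterBimodule.exists_lift k (m x) (he x) (hf x)
  refine ⟨DirectSum.toModule _ _ _ φ, fun x => ?_⟩
  rw [sumGen, DirectSum.toModule_lof, hφ]

theorem lact_sumGen (x : X) (he : e x * e x = e x) :
    lact k (e x) (sumGen k e f x) = sumGen k e f x := by
  rw [sumGen, ← map_lact, OuterBimodule.lact_gen k he]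

theorem ract_sumGen (x : X) (hf : f x * f x = f x) :
    ract k (f x) (sumGen k e f x) = sumGen k e f x := by
  rw [sumGen, ← map_ract, OuterBimodule.ract_gen k hf]

end OuterSum

theorem sum_projective {k : Type*} [Field k] {A : Type*} [Ring A] [Algebra k A] {X : Type*}
    {e f : X → A} (he : ∀ x, e x * e x = e x) (hf : ∀ x, f x * f x = f x) :
    Module.Projective (EnvelopingAlgebra k A) (⨁ x, OuterBimodule k (e x) (f x)) :=
  have := fun x => OuterBimodule.projective k (he x) (hf x)
  inferInstance

/-! ### Universal property of the path algebra. -/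

namespace PathAlgebra

variable {k : Type*} [Field k] {V : Type*} [Quiver V] {S : Type*} [Ring S] [Algebra k S]

/-- The value of a path under a representation of the quiver by elements of a ring. -/
def evalPath (E : V → S) (φ : ∀ {a b : V}, (a ⟶ b) → S) {a : V} : ∀ {b : V}, Quiver.Path a b → S
  | _, .nil => E a
  | _, .cons p g => evalPath E φ p * φ g

theorem evalPath_mul_end {E : V → S} {φ : ∀ {a b : V}, (a ⟶ b) → S} (hE : ∀ v, E v * E v = E v)
    (hφ : ∀ {a b : V} (g : a ⟶ b), φ g * E b = φ g) {a b : V} (p : Quiver.Path a b) :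
    evalPath E φ p * E b = evalPath E φ p := by
  cases p with
  | nil => exact hE a
  | cons p g => rw [evalPath, mul_assoc, hφ]

theorem start_mul_evalPath {E : V → S} {φ : ∀ {a b : V}, (a ⟶ b) → S} (hE : ∀ v, E v * E v = E v)
    {a b : V} (p : Quiver.Path a b) : E a * evalPath E φ p = evalPath E φ p := by
  induction p with
  | nil => exact hE a
  | cons p g ih => rw [evalPath, ← mul_assoc, ih]

theorem evalPath_comp {E : V → S} {φ : ∀ {a b : V}, (a ⟶ b) → S} (hE : ∀ v, E v * E v = E v)
    (hφ : ∀ {a b : V} (g : a ⟶ b), φ g * E b = φ g) {a b c : V} (p : Quiver.Path a b)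
    (q : Quiver.Path b c) : evalPath E φ (p.comp q) = evalPath E φ p * evalPath E φ q := by
  induction q with
  | nil => exact (evalPath_mul_end hE hφ p).symm
  | cons q g ih => rw [Quiver.Path.comp_cons, evalPath, ih, evalPath, mul_assoc]

/-- The algebra homomorphism from a path algebra given by orthogonal idempotents summing to one
and by images of the arrows. -/
theorem exists_algHom [Fintype V] (E : V → S) (φ : ∀ {a b : V}, (a ⟶ b) → S)
    (hE : ∀ v, E v * E v = E v) (hne : ∀ v w, v ≠ w → E v * E w = 0) (hsum : ∑ v, E v = 1)
    (hl : ∀ {a b : V} (g : a ⟶ b), E a * φ g = φ g)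
    (hr : ∀ {a b : V} (g : a ⟶ b), φ g * E b = φ g) :
    ∃ ρ : PathAlgebra k V →ₐ[k] S, (∀ v, ρ (ofPath (Quiver.Path.nil : Quiver.Path v v)) = E v) ∧
      ∀ {a b : V} (g : a ⟶ b), ρ (ofPath g.toPath) = φ g := by
  let f : PathAlgebra k V →ₗ[k] S := lift fun p => evalPath E φ p.2.2
  have hf : ∀ {a b : V} (p : Quiver.Path a b), f (ofPath p) = evalPath E φ p :=
    fun p => lift_ofPath _ p
  refine ⟨AlgHom.ofLinearMap f ?_ ?_, fun v => hf _, fun {a b} g => ?_⟩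
  · rw [one_def, map_sum, ← hsum]
    exact Finset.sum_congr rfl fun v _ => hf _
  · intro x y
    induction x using induction_on with
    | h0 => simp
    | hadd x x' hx hx' => simp only [add_mul, map_add, hx, hx']
    | hpath r a b p =>
      induction y using induction_on with
      | h0 => simp
      | hadd y y' hy hy' => simp only [mul_add, map_add, hy, hy']
      | hpath s c d q =>
        simp only [smul_mul_assoc, mul_smul_comm, map_smul, hf]
        congr 2
        by_cases h : c = b
        · subst h
          rw [ofPath_mul_ofPath, hf, evalPath_comp hE hr]
        · rw [ofPath_mul_ofPath_of_ne _ _ h, map_zero, ← evalPath_mul_end hE hr p,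
            ← start_mul_evalPath hE q, mul_assoc, ← mul_assoc (E b), hne b c (Ne.symm h), zero_mul,
            mul_zero]
  · exact (hf g.toPath).trans (hl g)

end PathAlgebra

/-! ### Words in `Γ` and the rewriting by mesh relations. -/

namespace TaftAuslander

variable (k : Type*) [Field k] {n : ℕ} [NeZero n]

/-- The arrow `(i, u) → (i + 1, u)` of `Γ`, or zero if there is none. -/
def arrA (i u : ZMod n) : Gam k n :=
  if h : u ≠ i + 1 - 1 then RingQuot.mkAlgHom k (MeshRel k n) (pa k (i + 1) u h) else 0

/-- The arrow `(i, u) → (i, u + 1)` of `Γ`, or zero if there is none. -/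
def arrB (i u : ZMod n) : Gam k n :=
  if h : u + 1 ≠ i then RingQuot.mkAlgHom k (MeshRel k n) (pb k i (u + 1) h) else 0

theorem arrA_self (i : ZMod n) : arrA k i i = 0 := by simp [arrA]

theorem arrB_end {i u : ZMod n} (h : u + 1 = i) : arrB k i u = 0 := by simp [arrB, h]

theorem idem_mul_self (i u : ZMod n) : idem k i u * idem k i u = idem k i u := by
  rw [idem, ← map_mul, PathAlgebra.ofPath_mul_ofPath, Quiver.Path.comp_nil]

theorem idem_mul_of_ne {i u i' u' : ZMod n} (h : (i, u) ≠ (i', u')) :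
    idem k i u * idem k i' u' = 0 := by
  rw [idem, idem, ← map_mul, PathAlgebra.ofPath_mul_ofPath_of_ne, map_zero]
  exact fun h' => h h'.symm

theorem sum_idem : ∑ v : ZMod n × ZMod n, idem k v.1 v.2 = 1 := by
  rw [← map_one (RingQuot.mkAlgHom k (MeshRel k n)), PathAlgebra.one_def, map_sum]
  rfl

theorem pa_congr {n : ℕ} {i i' u u' : ZMod n} (hi : i = i') (hu : u = u') (h : u ≠ i - 1)
    (h' : u' ≠ i' - 1) : pa k i u h = pa k i' u' h' := by
  subst hi hu
  rfl

theorem pb_congr {n : ℕ} {i i' u u' : ZMod n} (hi : i = i') (hu : u = u') (h : u ≠ i)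
    (h' : u' ≠ i') : pb k i u h = pb k i' u' h' := by
  subst hi hu
  rfl

theorem mk_pa (i u : ZMod n) (h : u ≠ i - 1) :
    RingQuot.mkAlgHom k (MeshRel k n) (pa k i u h) = arrA k (i - 1) u := by
  rw [arrA, dif_pos (by simpa using h)]
  exact congrArg _ (pa_congr k (by ring) rfl _ _)

theorem mk_pb (i u : ZMod n) (h : u ≠ i) :
    RingQuot.mkAlgHom k (MeshRel k n) (pb k i u h) = arrB k i (u - 1) := by
  rw [arrB, dif_pos (by simpa using h)]
  exact congrArg _ (pb_congr k rfl (by ring) _ _)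

theorem idem_mul_arrA (i u : ZMod n) : idem k i u * arrA k i u = arrA k i u := by
  rw [arrA]
  split_ifs with h
  · have : idem k i u = idem k (i + 1 - 1) u := by rw [add_sub_cancel_right]
    rw [this, idem, ← map_mul, pa, PathAlgebra.ofPath_mul_ofPath, Quiver.Path.nil_comp]
  · rw [mul_zero]

theorem arrA_mul_idem (i u : ZMod n) : arrA k i u * idem k (i + 1) u = arrA k i u := by
  rw [arrA]
  split_ifs with h
  · rw [idem, ← map_mul, pa, PathAlgebra.ofPath_mul_ofPath, Quiver.Path.comp_nil]
  · rw [zero_mul]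

theorem idem_mul_arrB (i u : ZMod n) : idem k i u * arrB k i u = arrB k i u := by
  rw [arrB]
  split_ifs with h
  · have : idem k i u = idem k i (u + 1 - 1) := by rw [add_sub_cancel_right]
    rw [this, idem, ← map_mul, pb, PathAlgebra.ofPath_mul_ofPath, Quiver.Path.nil_comp]
  · rw [mul_zero]

theorem arrB_mul_idem (i u : ZMod n) : arrB k i u * idem k i (u + 1) = arrB k i u := by
  rw [arrB]
  split_ifs with h
  · rw [idem, ← map_mul, pb, PathAlgebra.ofPath_mul_ofPath, Quiver.Path.comp_nil]
  · rw [zero_mul]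

/-- With missing arrows set to zero, the triangle relation is the square relation at `u + 1 = i`,
where the arrow `b` out of `(i, u)` does not exist. One formula then covers all meshes. -/
theorem mesh (hn : 2 ≤ n) {i u : ZMod n} (h : u ≠ i) :
    arrA k i u * arrB k (i + 1) u + arrB k i u * arrA k i (u + 1) = 0 := by
  have : Fact (1 < n) := ⟨hn⟩
  by_cases h' : u + 1 = i
  · have h1 : (i + 1 - 2 : ZMod n) ≠ i + 1 - 1 := by
      intro h2
      apply one_ne_zero (α := ZMod n)
      linear_combination -h2
    have h2 : (i + 1 - 1 : ZMod n) ≠ i + 1 := by simp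
    have := RingQuot.mkAlgHom_rel k (MeshRel.triangle (k := k) (i + 1) h1 h2)
    rw [map_mul, mk_pa, mk_pb, map_zero] at this
    rw [arrB_end k h', zero_mul, add_zero, ← this, ← h']
    congr 2 <;> ring
  · have h1 : u + 1 - 1 ≠ i + 1 - 1 := by simpa using h
    have h2 : u + 1 ≠ i + 1 := by simpa using h
    have h3 : u + 1 ≠ i + 1 - 1 := by simpa using h'
    have := RingQuot.mkAlgHom_rel k (MeshRel.square (k := k) (i + 1) (u + 1) h1 h2 h3 h3)
    rw [map_add, map_mul, map_mul, mk_pa, mk_pb, mk_pa, mk_pb, map_zero] at this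
    simpa only [add_sub_cancel_right] using this

/-- The path that starts at `(i, u)` and runs through `s` arrows `b` and then `t` arrows `a`. -/
def word : ZMod n → ZMod n → ℕ → ℕ → Gam k n
  | i, u, 0, 0 => idem k i u
  | i, u, 0, t + 1 => arrA k i u * word (i + 1) u 0 t
  | i, u, s + 1, t => arrB k i u * word i (u + 1) s t

/-- The condition for `word k i u s t` to be nonzero. -/
def Valid (i u : ZMod n) (s t : ℕ) : Prop := (u - i).val + s < n ∧ t ≤ (u - i).val + s

theorem word_zero (i u : ZMod n) : word k i u 0 0 = idem k i u := by rw [word]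

theorem word_a (i u : ZMod n) (t : ℕ) :
    word k i u 0 (t + 1) = arrA k i u * word k (i + 1) u 0 t := by rw [word]

theorem word_b (i u : ZMod n) (s t : ℕ) :
    word k i u (s + 1) t = arrB k i u * word k i (u + 1) s t := by rw [word]

theorem idem_mul_word (i u : ZMod n) (s t : ℕ) : idem k i u * word k i u s t = word k i u s t := by
  cases s with
  | zero =>
    cases t with
    | zero => rw [word_zero, idem_mul_self]
    | succ t => rw [word_a, ← mul_assoc, idem_mul_arrA]
  | succ s => rw [word_b, ← mul_assoc, idem_mul_arrB]

theorem idem_mul_word_of_ne {i u i' u' : ZMod n} (h : (i, u) ≠ (i', u')) (s t : ℕ) :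
    idem k i u * word k i' u' s t = 0 := by
  rw [← idem_mul_word, ← mul_assoc, idem_mul_of_ne k h, zero_mul]

/-- Each of the `s` arrows `b` that `a` passes costs one mesh relation, hence one sign. If the
induction meets a missing arrow `b`, both sides vanish. -/
theorem arrA_mul_word (hn : 2 ≤ n) {i u : ZMod n} (h : u ≠ i) (s t : ℕ) :
    arrA k i u * word k (i + 1) u s t = (-1 : ℤ) ^ s • word k i u s (t + 1) := by
  induction s generalizing u with
  | zero => rw [word_a, pow_zero, one_smul]
  | succ s ih =>
    rw [word_b, word_b, ← mul_assoc, eq_neg_of_add_eq_zero_left (mesh k hn h), neg_mul, mul_assoc]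
    by_cases h' : u + 1 = i
    · simp [arrB_end k h']
    · rw [ih h', mul_smul_comm, pow_succ, mul_neg_one, neg_smul]

/-- The height changes by exactly one along an arrow because wrapping around occurs only where the
arrow is missing. -/
theorem val_add_one_of_ne {x : ZMod n} (h : x + 1 ≠ 0) : (x + 1).val = x.val + 1 := by
  have hx : x + 1 = ((x.val + 1 : ℕ) : ZMod n) := by
    rw [Nat.cast_add, ZMod.natCast_zmod_val, Nat.cast_one]
  rw [hx, ZMod.val_natCast_of_lt]
  refine lt_of_le_of_ne x.val_lt fun h' => h ?_
  rw [hx, h', ZMod.natCast_self]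

/-- Height goes up by one while one arrow `b` fewer remains, so the height reached after the last
`b`, on which validity depends, is unchanged. -/
theorem valid_b {i u : ZMod n} (h : u + 1 ≠ i) (s t : ℕ) :
    Valid i u (s + 1) t ↔ Valid i (u + 1) s t := by
  have h1 : (u + 1 - i).val = (u - i).val + 1 := by
    rw [← val_add_one_of_ne]
    · congr 1; ring
    · intro h2; exact h (by linear_combination h2)
  simp only [Valid, h1]
  omega

theorem not_valid_b {i u : ZMod n} (h : u + 1 = i) (s t : ℕ) :
    ¬ Valid i u (s + 1) t := by
  have h1 : u - i = -1 := by linear_combination h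
  have h2 : (-1 : ZMod n).val = n - 1 := by
    obtain ⟨m, rfl⟩ := Nat.exists_eq_succ_of_ne_zero (NeZero.ne n)
    exact ZMod.val_neg_one m
  simp only [Valid, h1, h2]
  omega

theorem valid_a {i u : ZMod n} (h : u ≠ i) (s t : ℕ) :
    Valid (i + 1) u (s + 1) t ↔ (u - i).val + s < n ∧ t ≤ (u - i).val + s := by
  have h1 : (u - i).val = (u - (i + 1)).val + 1 := by
    rw [← val_add_one_of_ne]
    · congr 1; ring
    · intro h2; exact h (by linear_combination h2)
  simp only [Valid, h1]
  omega

/-- Guarantees that the homotopy may be evaluated on the leading term of `d₂` applied to a mesh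
generator times a valid word. -/
theorem valid_ab {i u : ZMod n} (h : u ≠ i) (s t : ℕ) :
    Valid (i + 1) u (s + 1) t ↔ Valid (i + 1) (u + 1) s t := by
  rw [valid_a h, Valid, add_sub_add_right_eq_sub]

theorem valid_a_zero {i u : ZMod n} (h : u ≠ i) (t : ℕ) :
    Valid i u 0 (t + 1) ↔ Valid (i + 1) u 0 t := by
  have h1 : (u - i).val = (u - (i + 1)).val + 1 := by
    rw [← val_add_one_of_ne]
    · congr 1; ring
    · intro h2; exact h (by linear_combination h2)
  have := (u - i).val_lt
  simp only [Valid, h1] at *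
  omega

theorem not_valid_a {n : ℕ} (i : ZMod n) (t : ℕ) : ¬ Valid i i 0 (t + 1) := by
  simp [Valid]

theorem valid_zero (i u : ZMod n) : Valid i u 0 0 := ⟨(u - i).val_lt, Nat.zero_le _⟩

end TaftAuslander

namespace TaftAuslander

/-! ### Linear independence of the valid words. -/

section Representation

variable (k : Type*) [Field k] {n : ℕ}

open Classical in
/-- The operator of left multiplication by an idempotent on formal words. -/
def opE (i u : ZMod n) : Module.End k (ZMod n × ZMod n × ℕ × ℕ →₀ k) :=
  Finsupp.linearCombination k fun w =>
    if w.1 = i ∧ w.2.1 = u then Finsupp.single w 1 else 0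

open Classical in
/-- The operator of left multiplication by an arrow `a` on formal words. -/
def opA (i u : ZMod n) : Module.End k (ZMod n × ZMod n × ℕ × ℕ →₀ k) :=
  Finsupp.linearCombination k fun w =>
    if w.1 = i + 1 ∧ w.2.1 = u ∧ Valid i u w.2.2.1 (w.2.2.2 + 1) then
      (-1 : ℤ) ^ w.2.2.1 • Finsupp.single (i, u, w.2.2.1, w.2.2.2 + 1) 1 else 0

open Classical in
/-- The operator of left multiplication by an arrow `b` on formal words. -/
def opB (i u : ZMod n) : Module.End k (ZMod n × ZMod n × ℕ × ℕ →₀ k) :=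
  Finsupp.linearCombination k fun w =>
    if w.1 = i ∧ w.2.1 = u + 1 ∧ Valid i u (w.2.2.1 + 1) w.2.2.2 then
      Finsupp.single (i, u, w.2.2.1 + 1, w.2.2.2) 1 else 0

open Classical in
theorem opE_single (i u i' u' : ZMod n) (s t : ℕ) :
    opE k i u (Finsupp.single (i', u', s, t) 1) =
      if i' = i ∧ u' = u then Finsupp.single (i', u', s, t) 1 else 0 :=
  (Finsupp.linearCombination_single k (1 : k) _).trans (one_smul k _)

open Classical in
theorem opA_single (i u i' u' : ZMod n) (s t : ℕ) :
    opA k i u (Finsupp.single (i', u', s, t) 1) =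
      if i' = i + 1 ∧ u' = u ∧ Valid i u s (t + 1) then
        (-1 : ℤ) ^ s • Finsupp.single (i, u, s, t + 1) 1 else 0 :=
  (Finsupp.linearCombination_single k (1 : k) _).trans (one_smul k _)

open Classical in
theorem opB_single (i u i' u' : ZMod n) (s t : ℕ) :
    opB k i u (Finsupp.single (i', u', s, t) 1) =
      if i' = i ∧ u' = u + 1 ∧ Valid i u (s + 1) t then
        Finsupp.single (i, u, s + 1, t) 1 else 0 :=
  (Finsupp.linearCombination_single k (1 : k) _).trans (one_smul k _)

theorem end_ext {f g : Module.End k (ZMod n × ZMod n × ℕ × ℕ →₀ k)}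
    (h : ∀ i u s t, f (Finsupp.single (i, u, s, t) 1) = g (Finsupp.single (i, u, s, t) 1)) :
    f = g :=
  Finsupp.lhom_ext' fun _ => LinearMap.ext_ring (h _ _ _ _)

theorem opE_mul_self (i u : ZMod n) : opE k i u * opE k i u = opE k i u := by
  refine end_ext k fun i' u' s t => ?_
  rw [Module.End.mul_apply, opE_single]
  split_ifs with h
  · rw [opE_single, if_pos h]
  · rw [map_zero]

theorem opE_mul_of_ne {i u i' u' : ZMod n} (h : (i, u) ≠ (i', u')) :
    opE k i u * opE k i' u' = 0 := by
  refine end_ext k fun i₁ u₁ s t => ?_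
  rw [Module.End.mul_apply, opE_single, LinearMap.zero_apply]
  split_ifs with h'
  · rw [opE_single, if_neg]
    rintro ⟨rfl, rfl⟩
    exact h (Prod.ext h'.1 h'.2)
  · rw [map_zero]

theorem sum_opE [NeZero n] : ∑ v : ZMod n × ZMod n, opE k v.1 v.2 = 1 := by
  refine end_ext k fun i u s t => ?_
  rw [LinearMap.sum_apply, Finset.sum_eq_single (i, u)]
  · rw [opE_single, if_pos ⟨rfl, rfl⟩, Module.End.one_apply]
  · rintro ⟨i', u'⟩ - h
    rw [opE_single, if_neg]
    rintro ⟨rfl, rfl⟩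
    exact h rfl
  · simp

theorem opE_mul_opA (i u : ZMod n) : opE k i u * opA k i u = opA k i u := by
  refine end_ext k fun i' u' s t => ?_
  rw [Module.End.mul_apply, opA_single]
  split_ifs with h
  · rw [map_zsmul, opE_single, if_pos ⟨rfl, rfl⟩]
  · rw [map_zero]

theorem opA_mul_opE (i u : ZMod n) : opA k i u * opE k (i + 1) u = opA k i u := by
  refine end_ext k fun i' u' s t => ?_
  rw [Module.End.mul_apply, opE_single]
  split_ifs with h
  · rfl
  · rw [map_zero, opA_single, if_neg fun h' => h ⟨h'.1, h'.2.1⟩]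

theorem opE_mul_opB (i u : ZMod n) : opE k i u * opB k i u = opB k i u := by
  refine end_ext k fun i' u' s t => ?_
  rw [Module.End.mul_apply, opB_single]
  split_ifs with h
  · rw [opE_single, if_pos ⟨rfl, rfl⟩]
  · rw [map_zero]

theorem opB_mul_opE (i u : ZMod n) : opB k i u * opE k i (u + 1) = opB k i u := by
  refine end_ext k fun i' u' s t => ?_
  rw [Module.End.mul_apply, opE_single]
  split_ifs with h
  · rfl
  · rw [map_zero, opB_single, if_neg fun h' => h ⟨h'.1, h'.2.1⟩]

theorem opB_end [NeZero n] {i u : ZMod n} (h : u + 1 = i) : opB k i u = 0 := by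
  refine end_ext k fun i' u' s t => ?_
  rw [opB_single, if_neg fun h' => not_valid_b h _ _ h'.2.2, LinearMap.zero_apply]

/-- Both composites send the formal word `(i + 1, u + 1, s, t)` to a multiple of `(i, u, s + 1, t +
1)`. The operator of `a` sees `s + 1` arrows `b` in one order and `s` in the other, so the signs are
opposite; both composites vanish when the target is not valid. -/
theorem op_mesh [NeZero n] {i u : ZMod n} (h : u ≠ i) :
    opA k i u * opB k (i + 1) u + opB k i u * opA k i (u + 1) = 0 := by
  refine end_ext k fun i' u' s t => ?_
  rw [LinearMap.add_apply, Module.End.mul_apply, Module.End.mul_apply, opB_single, opA_single,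
    LinearMap.zero_apply]
  by_cases h0 : i' = i + 1 ∧ u' = u + 1
  · obtain ⟨rfl, rfl⟩ := h0
    by_cases hu : u + 1 = i
    · rw [opB_end k hu, LinearMap.zero_apply, add_zero]
      split_ifs with h1
      · rw [opA_single, if_neg fun h' => not_valid_b hu _ _ h'.2.2]
      · rw [map_zero]
    · by_cases hv : Valid i u (s + 1) (t + 1)
      · have hv' : Valid (i + 1) u (s + 1) t := by
          rw [valid_a h]
          simp only [Valid] at hv
          omega
        rw [if_pos ⟨rfl, rfl, hv'⟩, if_pos ⟨rfl, rfl, (valid_b hu _ _).1 hv⟩, map_zsmul,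
          opA_single, opB_single, if_pos ⟨rfl, rfl, hv⟩, if_pos ⟨rfl, rfl, hv⟩, pow_succ,
          mul_neg_one, neg_smul, neg_add_cancel]
      · have hv' : ¬ Valid i (u + 1) s (t + 1) := mt (valid_b hu _ _).2 hv
        simp only [hv', and_false, if_false, map_zero, add_zero]
        split_ifs
        · rw [opA_single, if_neg fun h' => hv h'.2.2]
        · rw [map_zero]
  · rw [if_neg fun h' => h0 ⟨h'.1, h'.2.1⟩, if_neg fun h' => h0 ⟨h'.1, h'.2.1⟩, map_zero,
      map_zero, add_zero]

/-- The operator attached to an arrow of the quiver. -/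
def opArrow : ∀ {v w : Vertex n}, (v ⟶ w) → Module.End k (ZMod n × ZMod n × ℕ × ℕ →₀ k)
  | _, _, Arrow.a i u _ => opA k (i - 1) u
  | _, _, Arrow.b i u _ => opB k i (u - 1)

variable [NeZero n]

/-- The restriction `u ≠ i` matters: `arrA k i i` is zero, but `opA k i i` need not vanish on formal
words. No restriction is needed for `b`, since `opB` is zero at a missing arrow by `opB_end`. -/
theorem exists_rep :
    ∃ ρ : Gam k n →ₐ[k] Module.End k (ZMod n × ZMod n × ℕ × ℕ →₀ k),
      (∀ i u, ρ (idem k i u) = opE k i u) ∧ (∀ i u, u ≠ i → ρ (arrA k i u) = opA k i u) ∧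
      ∀ i u, ρ (arrB k i u) = opB k i u := by
  obtain ⟨ρ, h1, h2⟩ := PathAlgebra.exists_algHom (k := k) (V := Vertex n)
    (S := Module.End k (ZMod n × ZMod n × ℕ × ℕ →₀ k))
    (fun v => opE k v.1 v.2) (fun g => opArrow k g) (fun v => opE_mul_self k v.1 v.2)
    (fun v w h => opE_mul_of_ne k h) (by rw [← sum_opE k]; rfl)
    (by
      rintro _ _ (⟨i, u, h⟩ | ⟨i, u, h⟩)
      · exact opE_mul_opA k (i - 1) u
      · exact opE_mul_opB k i (u - 1))
    (by
      rintro _ _ (⟨i, u, h⟩ | ⟨i, u, h⟩)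
      · have := opA_mul_opE k (i - 1) u
        rw [sub_add_cancel] at this
        exact this
      · have := opB_mul_opE k i (u - 1)
        rw [sub_add_cancel] at this
        exact this)
  have ha : ∀ i u h, ρ (pa k i u h) = opA k (i - 1) u := fun i u h => h2 _
  have hb : ∀ i u h, ρ (pb k i u h) = opB k i (u - 1) := fun i u h => h2 _
  refine ⟨RingQuot.liftAlgHom k ⟨ρ, ?_⟩, fun i u => ?_, fun i u h => ?_, fun i u => ?_⟩
  · intro x y hxy
    cases hxy with
    | triangle i h h' =>
      have := op_mesh k (i := i - 1) (u := i - 2) h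
      rw [opB_end k (show i - 2 + 1 = i - 1 by ring), zero_mul, add_zero] at this
      rw [map_mul, ha, hb, map_zero, ← this]
      congr 2 <;> ring
    | square i u h h' h'' h''' =>
      have := op_mesh k (i := i - 1) (u := u - 1) h
      rw [sub_add_cancel, sub_add_cancel] at this
      rw [map_add, map_mul, map_mul, ha, hb, ha, hb, map_zero, ← this]
  · rw [idem, RingQuot.liftAlgHom_mkAlgHom_apply, h1]
    rfl
  · rw [arrA, dif_pos (by simpa using h), RingQuot.liftAlgHom_mkAlgHom_apply, ha,
      add_sub_cancel_right]
  · rw [arrB]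
    split_ifs with h
    · rw [RingQuot.liftAlgHom_mkAlgHom_apply, hb, add_sub_cancel_right]
    · rw [map_zero, opB_end k (not_not.1 h)]

/-- Nonzero words are linearly independent: there are linear coordinates on `Γ`. -/
theorem exists_coord : ∃ Ψ : Gam k n →ₗ[k] (ZMod n × ZMod n × ℕ × ℕ →₀ k),
    ∀ i u s t, Valid i u s t → Ψ (word k i u s t) = Finsupp.single (i, u, s, t) 1 := by
  obtain ⟨ρ, he, ha, hb⟩ := exists_rep k (n := n)
  -- The sum of the empty words plays the role of the unit: letting a valid word of `Γ` act on it
  -- rebuilds that word formally, letter by letter from the right.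
  refine ⟨(LinearMap.applyₗ (∑ v : ZMod n × ZMod n, Finsupp.single (v.1, v.2, 0, 0) 1)).comp
    ρ.toLinearMap, fun i u s t h => ?_⟩
  simp only [LinearMap.comp_apply, LinearMap.applyₗ_apply_apply, AlgHom.toLinearMap_apply]
  induction s generalizing u with
  | zero =>
    induction t generalizing i with
    | zero =>
      rw [word_zero, he, map_sum, Finset.sum_eq_single (i, u)]
      · rw [opE_single, if_pos ⟨rfl, rfl⟩]
      · rintro ⟨i', u'⟩ - h
        rw [opE_single, if_neg]
        rintro ⟨rfl, rfl⟩
        exact h rfl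
      · simp
    | succ t ih =>
      by_cases hu : u = i
      · subst hu
        exact absurd h (not_valid_a _ _)
      · rw [word_a, map_mul, ha i u hu, Module.End.mul_apply, ih _ ((valid_a_zero hu t).1 h),
          opA_single, if_pos ⟨rfl, rfl, h⟩, pow_zero, one_smul]
  | succ s ih =>
    by_cases hu : u + 1 = i
    · exact absurd h (not_valid_b hu _ _)
    · rw [word_b, map_mul, hb, Module.End.mul_apply, ih _ ((valid_b hu s t).1 h),
        opB_single, if_pos ⟨rfl, rfl, h⟩]

theorem idem_ne_zero (i u : ZMod n) : idem k i u ≠ 0 := by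
  obtain ⟨Ψ, h⟩ := exists_coord k (n := n)
  intro h0
  have := h i u 0 0 (valid_zero i u)
  rw [word_zero, h0, map_zero] at this
  simpa using this.symm

end Representation

/-! ### The filtration of `Γ` by word length. -/

section Filtration

variable (k : Type*) [Field k] {n : ℕ} [NeZero n]

/-- The span of the words of length at least `m`. -/
def lenSpan (n : ℕ) [NeZero n] (m : ℕ) : Submodule k (Gam k n) :=
  Submodule.span k {x | ∃ i u s t, m ≤ s + t ∧ word k i u s t = x}

theorem word_mem {m : ℕ} (i u : ZMod n) {s t : ℕ} (h : m ≤ s + t) :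
    word k i u s t ∈ lenSpan k n m :=
  Submodule.subset_span ⟨i, u, s, t, h, rfl⟩

theorem arrA_eq_word (i u : ZMod n) : arrA k i u = word k i u 0 1 := by
  rw [word_a, word_zero, arrA_mul_idem]

theorem arrB_eq_word (i u : ZMod n) : arrB k i u = word k i u 1 0 := by
  rw [word_b, word_zero, arrB_mul_idem]

theorem arrA_mem (i u : ZMod n) : arrA k i u ∈ lenSpan k n 1 := by
  rw [arrA_eq_word]
  exact word_mem k i u le_rfl

theorem arrB_mem (i u : ZMod n) : arrB k i u ∈ lenSpan k n 1 := by
  rw [arrB_eq_word]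
  exact word_mem k i u le_rfl

theorem lenSpan_le_comap {m m' : ℕ} {f : Gam k n →ₗ[k] Gam k n}
    (h : ∀ i u s t, m ≤ s + t → f (word k i u s t) ∈ lenSpan k n m') {x : Gam k n}
    (hx : x ∈ lenSpan k n m) : f x ∈ lenSpan k n m' := by
  suffices lenSpan k n m ≤ (lenSpan k n m').comap f from this hx
  refine Submodule.span_le.2 ?_
  rintro _ ⟨i, u, s, t, hm, rfl⟩
  exact h i u s t hm

theorem idem_mul_mem (i u : ZMod n) {m : ℕ} {x : Gam k n} (hx : x ∈ lenSpan k n m) :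
    idem k i u * x ∈ lenSpan k n m := by
  refine lenSpan_le_comap k (f := LinearMap.mulLeft k (idem k i u)) (fun i' u' s t h => ?_) hx
  rw [LinearMap.mulLeft_apply]
  by_cases h' : (i, u) = (i', u')
  · cases h'
    rw [idem_mul_word]
    exact word_mem k i u h
  · rw [idem_mul_word_of_ne k h']
    exact zero_mem _

theorem arrA_mul_mem (hn : 2 ≤ n) (i u : ZMod n) {m : ℕ} {x : Gam k n}
    (hx : x ∈ lenSpan k n m) : arrA k i u * x ∈ lenSpan k n (m + 1) := by
  refine lenSpan_le_comap k (f := LinearMap.mulLeft k (arrA k i u)) (fun i' u' s t h => ?_) hx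
  rw [LinearMap.mulLeft_apply]
  by_cases h' : (i + 1, u) = (i', u')
  · cases h'
    by_cases hu : u = i
    · subst hu
      rw [arrA_self, zero_mul]
      exact zero_mem _
    · rw [arrA_mul_word k hn hu]
      exact zsmul_mem (word_mem k i u (by omega)) _
  · rw [← arrA_mul_idem, mul_assoc, idem_mul_word_of_ne k h', mul_zero]
    exact zero_mem _

theorem arrB_mul_mem (i u : ZMod n) {m : ℕ} {x : Gam k n}
    (hx : x ∈ lenSpan k n m) : arrB k i u * x ∈ lenSpan k n (m + 1) := by
  refine lenSpan_le_comap k (f := LinearMap.mulLeft k (arrB k i u)) (fun i' u' s t h => ?_) hx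
  rw [LinearMap.mulLeft_apply]
  by_cases h' : (i, u + 1) = (i', u')
  · cases h'
    rw [← word_b]
    exact word_mem k i u (by omega)
  · rw [← arrB_mul_idem, mul_assoc, idem_mul_word_of_ne k h', mul_zero]
    exact zero_mem _

/-- The mesh relations are homogeneous, so bringing a product to normal form does not shorten it. -/
theorem word_mul_mem (hn : 2 ≤ n) (i u : ZMod n) (s t : ℕ) {m : ℕ} {x : Gam k n}
    (hx : x ∈ lenSpan k n m) : word k i u s t * x ∈ lenSpan k n (s + t + m) := by
  induction s generalizing u with
  | zero =>
    induction t generalizing i with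
    | zero =>
      rw [word_zero, zero_add, zero_add]
      exact idem_mul_mem k i u hx
    | succ t ih =>
      rw [word_a, mul_assoc]
      convert arrA_mul_mem k hn i u (ih (i + 1)) using 2
      omega
  | succ s ih =>
    rw [word_b, mul_assoc]
    convert arrB_mul_mem k i u (ih (u + 1)) using 2
    omega

theorem lenSpan_anti {m m' : ℕ} (h : m ≤ m') : lenSpan k n m' ≤ lenSpan k n m := by
  refine Submodule.span_mono ?_
  rintro _ ⟨i, u, s, t, hm, rfl⟩
  exact ⟨i, u, s, t, h.trans hm, rfl⟩

theorem mul_mem_lenSpan (hn : 2 ≤ n) {m m' : ℕ} {x y : Gam k n} (hx : x ∈ lenSpan k n m)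
    (hy : y ∈ lenSpan k n m') : x * y ∈ lenSpan k n (m + m') := by
  refine lenSpan_le_comap k (f := LinearMap.mulRight k y) (fun i u s t h => ?_) hx
  exact lenSpan_anti k (by omega) (word_mul_mem k hn i u s t hy)

/-- The span of the words contains the trivial paths and the arrows and is closed under products, so
it contains the image of every path. -/
theorem lenSpan_zero (hn : 2 ≤ n) : lenSpan k n 0 = ⊤ := by
  have h1 : (1 : Gam k n) ∈ lenSpan k n 0 := by
    rw [← sum_idem]
    refine sum_mem fun v _ => ?_
    rw [← word_zero]
    exact word_mem k _ _ le_rfl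
  have harrow : ∀ {v w : Vertex n} (g : v ⟶ w),
      RingQuot.mkAlgHom k (MeshRel k n) (PathAlgebra.ofPath g.toPath) ∈ lenSpan k n 0 := by
    rintro _ _ (⟨i, u, h⟩ | ⟨i, u, h⟩)
    · have := lenSpan_anti k zero_le_one (arrA_mem k (i - 1) u)
      rw [← mk_pa k i u h] at this
      exact this
    · have := lenSpan_anti k zero_le_one (arrB_mem k i (u - 1))
      rw [← mk_pb k i u h] at this
      exact this
  have hpath : ∀ {v w : Vertex n} (p : Quiver.Path v w),
      RingQuot.mkAlgHom k (MeshRel k n) (PathAlgebra.ofPath p) ∈ lenSpan k n 0 := by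
    intro v w p
    induction p with
    | nil =>
      have := word_mem k (m := 0) v.1 v.2 (s := 0) (t := 0) le_rfl
      rw [word_zero] at this
      exact this
    | cons p g ih =>
      have := mul_mem_lenSpan k hn ih (harrow g)
      rw [← map_mul, PathAlgebra.ofPath_mul_ofPath] at this
      exact this
  refine eq_top_iff.2 fun x _ => ?_
  obtain ⟨x, rfl⟩ := RingQuot.mkAlgHom_surjective k (MeshRel k n) x
  induction x using PathAlgebra.induction_on with
  | h0 => rw [map_zero]; exact zero_mem _
  | hadd x y hx hy => rw [map_add]; exact add_mem (hx trivial) (hy trivial)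
  | hpath r a b p => rw [map_smul]; exact Submodule.smul_mem _ _ (hpath p)

/-- Stripping the first arrow preserves failure of validity, so eventually a missing arrow is
reached, which is zero by convention. -/
theorem word_eq_zero {i u : ZMod n} {s t : ℕ} (h : ¬ Valid i u s t) : word k i u s t = 0 := by
  induction s generalizing u with
  | zero =>
    induction t generalizing i with
    | zero => exact absurd (valid_zero i u) h
    | succ t ih =>
      rw [word_a]
      by_cases hu : u = i
      · rw [hu, arrA_self, zero_mul]
      · rw [ih (mt (valid_a_zero hu t).2 h), mul_zero]
  | succ s ih =>
    rw [word_b]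
    by_cases hu : u + 1 = i
    · rw [arrB_end k hu, zero_mul]
    · rw [ih (mt (valid_b hu s t).2 h), mul_zero]

/-- A valid word has fewer than `n` arrows of each kind. -/
theorem lenSpan_eq_bot {m : ℕ} (h : 2 * n ≤ m) : lenSpan k n m = ⊥ := by
  rw [lenSpan, Submodule.span_eq_bot]
  rintro _ ⟨i, u, s, t, hm, rfl⟩
  refine word_eq_zero k fun hv => ?_
  have := hv.1
  have := hv.2
  omega

end Filtration

end TaftAuslander

namespace TaftAuslander

variable (k : Type*) [Field k] {n : ℕ} [NeZero n]

/-! ### Additive maps prescribed and compared on words. -/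

section Words

variable {M : Type*} [AddCommGroup M] [Module (EnvelopingAlgebra k (Gam k n)) M]
  {N : Type*} [AddCommGroup N] [Module (EnvelopingAlgebra k (Gam k n)) N]

/-- Independence of the valid words allows arbitrary values on them; this is the only way in which
the linear coordinates on `Γ` enter the homotopy. -/
theorem exists_hom_word (D : ZMod n → ZMod n → ℕ → ℕ → M) : ∃ H : Gam k n →+ M,
    (∀ (c : k) q, H (c • q) = algebraMap k (EnvelopingAlgebra k (Gam k n)) c • H q) ∧
    ∀ i u s t, Valid i u s t → H (word k i u s t) = D i u s t := by
  obtain ⟨Ψ, hΨ⟩ := exists_coord k (n := n)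
  let _ : Module k M := Module.compHom M (algebraMap k (EnvelopingAlgebra k (Gam k n)))
  refine ⟨((Finsupp.linearCombination k fun w : ZMod n × ZMod n × ℕ × ℕ =>
    D w.1 w.2.1 w.2.2.1 w.2.2.2).comp Ψ).toAddMonoidHom, fun c q => ?_, fun i u s t h => ?_⟩
  · exact map_smul ((Finsupp.linearCombination k fun w : ZMod n × ZMod n × ℕ × ℕ =>
      D w.1 w.2.1 w.2.2.1 w.2.2.2).comp Ψ) c q
  · change Finsupp.linearCombination k _ (Ψ (word k i u s t)) = _
    rw [hΨ i u s t h, Finsupp.linearCombination_single, one_smul]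

/-- By left linearity only right multiples of `m` matter, and words span `Γ`. Words not starting at
`(i, u)` annihilate `m` by `hm`, and words that are not valid are zero. -/
theorem eq_on_of_word (hn : 2 ≤ n) {φ ψ : M →+ N}
    (hφ : ∀ (p : Gam k n) m, φ (lact k p m) = lact k p (φ m))
    (hψ : ∀ (p : Gam k n) m, ψ (lact k p m) = lact k p (ψ m)) {m : M} {i u : ZMod n}
    (hm : ract k (idem k i u) m = m)
    (h : ∀ s t, Valid i u s t → φ (ract k (word k i u s t) m) = ψ (ract k (word k i u s t) m))
    (p q : Gam k n) : φ (lact k p (ract k q m)) = ψ (lact k p (ract k q m)) := by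
  rw [hφ, hψ]
  congr 1
  have hq : q ∈ lenSpan k n 0 := by rw [lenSpan_zero k hn]; trivial
  induction hq using Submodule.span_induction with
  | mem x hx =>
    obtain ⟨i', u', s, t, -, rfl⟩ := hx
    by_cases h' : (i, u) = (i', u')
    · cases h'
      by_cases hv : Valid i u s t
      · exact h s t hv
      · rw [word_eq_zero k hv]
        simp
    · rw [← hm, ← ract_mul, idem_mul_word_of_ne k h']
      simp
  | zero => simp
  | add x y _ _ hx hy => simp only [map_add, AddMonoidHom.add_apply, hx, hy]
  | smul c x _ hx =>
    -- Scalars act centrally, so one on the right can be moved to the left, where the maps are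
    -- linear.
    have hc : ract k (c • x) m = lact k (c • (1 : Gam k n)) (ract k x m) := by
      rw [ract_smul, lact_smul, lact_one]
    rw [hc, hφ, hψ, hx]

end Words

/-! ### Nakayama's lemma for the length filtration. -/

section Superfluous

variable (n) {M : Type*} [AddCommGroup M] [Module (EnvelopingAlgebra k (Gam k n)) M]
  {X : Type*} (g : X → M)

/-- The radical of a bimodule generated by elements `g x`. -/
def radGen : AddSubgroup M :=
  AddSubgroup.closure {m | ∃ (x : X) (p q : Gam k n) (a b : ℕ), p ∈ lenSpan k n a ∧ q ∈ lenSpan k n b ∧ 1 ≤ a + b ∧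
    lact k p (ract k q (g x)) = m}

variable {n} {g}

theorem mem_lenSpan_zero (hn : 2 ≤ n) (x : Gam k n) : x ∈ lenSpan k n 0 := by
  rw [lenSpan_zero k hn]
  trivial

theorem lact_mem_radGen (hn : 2 ≤ n) {p : Gam k n} (hp : p ∈ lenSpan k n 1) (x : X) :
    lact k p (g x) ∈ radGen k n g := by
  refine AddSubgroup.subset_closure ⟨x, p, 1, 1, 0, hp, mem_lenSpan_zero k hn 1, le_rfl, ?_⟩
  rw [ract_one]

theorem ract_mem_radGen (hn : 2 ≤ n) {q : Gam k n} (hq : q ∈ lenSpan k n 1) (x : X) :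
    ract k q (g x) ∈ radGen k n g := by
  refine AddSubgroup.subset_closure ⟨x, 1, q, 0, 1, mem_lenSpan_zero k hn 1, hq, le_rfl, ?_⟩
  rw [lact_one]

theorem lact_ract_mem_radGen (hn : 2 ≤ n) (p q : Gam k n) {m : M} (hm : m ∈ radGen k n g) :
    lact k p (ract k q m) ∈ radGen k n g := by
  suffices radGen k n g ≤ (radGen k n g).comap ((lact k p).comp (ract k q)) from this hm
  refine (AddSubgroup.closure_le _).2 ?_
  rintro _ ⟨x, p', q', a, b, hp, hq, hab, rfl⟩
  change lact k p (ract k q (lact k p' (ract k q' (g x)))) ∈ radGen k n g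
  rw [ract_lact, ← lact_mul, ← ract_mul]
  refine AddSubgroup.subset_closure ⟨x, _, _, a, b, ?_, ?_, hab, rfl⟩
  · simpa using mul_mem_lenSpan k hn (mem_lenSpan_zero k hn p) hp
  · simpa using mul_mem_lenSpan k hn hq (mem_lenSpan_zero k hn q)

/-- Sub-bimodules of the radical are superfluous. -/
theorem isSuperfluous_of_le_radGen (hn : 2 ≤ n)
    (hg : ∀ S : AddSubgroup M, (∀ x (p q : Gam k n), lact k p (ract k q (g x)) ∈ S) → ∀ m, m ∈ S)
    {N : Submodule (EnvelopingAlgebra k (Gam k n)) M} (hN : ∀ m ∈ N, m ∈ radGen k n g) :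
    N.IsSuperfluous := by
  intro L hL
  -- The number `j` bounds how far the total degree `a + b` is from `4 * n`. At `4 * n` one factor
  -- has degree at least `2 * n` and is zero. Below that, writing `g x` as an element of `N` plus
  -- one of `L` replaces it, modulo `L`, by terms of larger total degree.
  have key : ∀ (j : ℕ) (x : X) (p q : Gam k n) (a b : ℕ), p ∈ lenSpan k n a → q ∈ lenSpan k n b → 4 * n ≤ a + b + j →
      lact k p (ract k q (g x)) ∈ L := by
    intro j
    induction j with
    | zero =>
      intro x p q a b hp hq hab
      rcases (by omega : 2 * n ≤ a ∨ 2 * n ≤ b) with h | h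
      · rw [lenSpan_eq_bot k h, Submodule.mem_bot] at hp
        rw [hp, map_zero, AddMonoidHom.zero_apply]
        exact L.zero_mem
      · rw [lenSpan_eq_bot k h, Submodule.mem_bot] at hq
        rw [hq, map_zero, AddMonoidHom.zero_apply, map_zero]
        exact L.zero_mem
    | succ j ih =>
      intro x p q a b hp hq hab
      have hx : g x ∈ N ⊔ L := hL ▸ Submodule.mem_top
      obtain ⟨y, hy, l, hl, hyl⟩ := Submodule.mem_sup.1 hx
      rw [← hyl, map_add, map_add]
      refine L.add_mem ?_ (lact_mem k L p (ract_mem k L q hl))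
      suffices radGen k n g ≤ L.toAddSubgroup.comap ((lact k p).comp (ract k q)) from
        this (hN y hy)
      refine (AddSubgroup.closure_le _).2 ?_
      rintro _ ⟨x', p', q', a', b', hp', hq', hab', rfl⟩
      change lact k p (ract k q (lact k p' (ract k q' (g x')))) ∈ L
      rw [ract_lact, ← lact_mul, ← ract_mul]
      exact ih x' _ _ (a + a') (b' + b) (mul_mem_lenSpan k hn hp hp')
        (mul_mem_lenSpan k hn hq' hq) (by omega)
  refine eq_top_iff.2 fun m _ => hg L.toAddSubgroup (fun x p q => ?_) m
  exact key (4 * n) x p q 0 0 (mem_lenSpan_zero k hn p) (mem_lenSpan_zero k hn q) (by omega)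

end Superfluous

/-! ### Generators of the terms and maps defined on them. -/

section Generators

/-- The generator of `R₀` at the vertex `(i, u)`. -/
def gen₀ (i u : ZMod n) : R₀ k n :=
  sumGen k (fun x : ZMod n × ZMod n => idem k x.1 x.2) (fun x => idem k x.1 x.2) (i, u)

/-- The generator of `R₁` at the arrow `(i, u) → (i + 1, u)`, or zero. -/
def genA (i u : ZMod n) : R₁ k n :=
  if h : u ≠ i + 1 - 1 then
    (sumGen k (fun x : {x : ZMod n × ZMod n // x.2 ≠ x.1 - 1} => idem k (x.1.1 - 1) x.1.2)
      (fun x => idem k x.1.1 x.1.2) ⟨(i + 1, u), h⟩, 0)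
  else 0

/-- The generator of `R₁` at the arrow `(i, u) → (i, u + 1)`, or zero. -/
def genB (i u : ZMod n) : R₁ k n :=
  if h : u + 1 ≠ i then
    (0, sumGen k (fun x : {x : ZMod n × ZMod n // x.2 ≠ x.1} => idem k x.1.1 (x.1.2 - 1))
      (fun x => idem k x.1.1 x.1.2) ⟨(i, u + 1), h⟩)
  else 0

/-- The generator of `R₂` at the mesh from `(i, u)` to `(i + 1, u + 1)`, or zero. -/
def gen₂ (i u : ZMod n) : R₂ k n :=
  if h : i + 1 ≠ u + 1 then
    sumGen k (fun x : {x : ZMod n × ZMod n // x.1 ≠ x.2} => idem k (x.1.1 - 1) (x.1.2 - 1))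
      (fun x => idem k x.1.1 x.1.2) ⟨(i + 1, u + 1), h⟩
  else 0

theorem genA_self (i : ZMod n) : genA k i i = 0 := by simp [genA]

theorem genB_end {i u : ZMod n} (h : u + 1 = i) : genB k i u = 0 := by simp [genB, h]

theorem mem_of_gen₀ (S : AddSubgroup (R₀ k n))
    (h : ∀ i u (p q : Gam k n), lact k p (ract k q (gen₀ k i u)) ∈ S) (m : R₀ k n) : m ∈ S :=
  mem_of_sumGen k _ _ S (fun x p q => h x.1 x.2 p q) m

theorem mem_of_gen₁ (S : AddSubgroup (R₁ k n))
    (hA : ∀ i u, u ≠ i → ∀ p q : Gam k n, lact k p (ract k q (genA k i u)) ∈ S)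
    (hB : ∀ i u, u + 1 ≠ i → ∀ p q : Gam k n, lact k p (ract k q (genB k i u)) ∈ S)
    (m : R₁ k n) : m ∈ S := by
  obtain ⟨x, y⟩ := m
  have hx : (x, 0) ∈ S := by
    refine mem_of_sumGen k _ _ (S.comap (AddMonoidHom.inl _ _)) (fun z p q => ?_) x
    obtain ⟨⟨i, u⟩, hz⟩ := z
    obtain ⟨i, rfl⟩ : ∃ j, i = j + 1 := ⟨i - 1, by ring⟩
    have := hA i u (by simpa using hz) p q
    rw [genA, dif_pos hz] at this
    have h0 : lact k p (ract k q (0 : ⨁ x : {x : ZMod n × ZMod n // x.2 ≠ x.1},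
      ProjBimod k x.1.1 (x.1.2 - 1) x.1.1 x.1.2)) = 0 := by rw [map_zero, map_zero]
    rw [AddSubgroup.mem_comap, AddMonoidHom.inl_apply, ← h0]
    exact this
  have hy : (0, y) ∈ S := by
    refine mem_of_sumGen k _ _ (S.comap (AddMonoidHom.inr _ _)) (fun z p q => ?_) y
    obtain ⟨⟨i, u⟩, hz⟩ := z
    obtain ⟨u, rfl⟩ : ∃ j, u = j + 1 := ⟨u - 1, by ring⟩
    have := hB i u hz p q
    rw [genB, dif_pos hz] at this
    have h0 : lact k p (ract k q (0 : ⨁ x : {x : ZMod n × ZMod n // x.2 ≠ x.1 - 1},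
      ProjBimod k (x.1.1 - 1) x.1.2 x.1.1 x.1.2)) = 0 := by rw [map_zero, map_zero]
    rw [AddSubgroup.mem_comap, AddMonoidHom.inr_apply, ← h0]
    exact this
  simpa using S.add_mem hx hy

theorem mem_of_gen₂ (S : AddSubgroup (R₂ k n))
    (h : ∀ i u, u ≠ i → ∀ p q : Gam k n, lact k p (ract k q (gen₂ k i u)) ∈ S) (m : R₂ k n) : m ∈ S := by
  refine mem_of_sumGen k _ _ S (fun z p q => ?_) m
  obtain ⟨⟨i, u⟩, hz⟩ := z
  obtain ⟨i, rfl⟩ : ∃ j, i = j + 1 := ⟨i - 1, by ring⟩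
  obtain ⟨u, rfl⟩ : ∃ j, u = j + 1 := ⟨u - 1, by ring⟩
  have := h i u (fun h => hz (by rw [h])) p q
  rwa [gen₂, dif_pos hz] at this

theorem lact_gen₀ (i u : ZMod n) : lact k (idem k i u) (gen₀ k i u) = gen₀ k i u :=
  lact_sumGen k (e := fun x : ZMod n × ZMod n => idem k x.1 x.2)
    (f := fun x => idem k x.1 x.2) (i, u) (idem_mul_self k i u)

theorem ract_gen₀ (i u : ZMod n) : ract k (idem k i u) (gen₀ k i u) = gen₀ k i u :=
  ract_sumGen k (e := fun x : ZMod n × ZMod n => idem k x.1 x.2)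
    (f := fun x => idem k x.1 x.2) (i, u) (idem_mul_self k i u)

theorem lact_prod {M N : Type*} [AddCommGroup M] [Module (EnvelopingAlgebra k (Gam k n)) M]
    [AddCommGroup N] [Module (EnvelopingAlgebra k (Gam k n)) N] (p : Gam k n) (x : M) (y : N) :
    lact k p (x, y) = (lact k p x, lact k p y) := rfl

theorem ract_prod {M N : Type*} [AddCommGroup M] [Module (EnvelopingAlgebra k (Gam k n)) M]
    [AddCommGroup N] [Module (EnvelopingAlgebra k (Gam k n)) N] (p : Gam k n) (x : M) (y : N) :
    ract k p (x, y) = (ract k p x, ract k p y) := rfl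

theorem lact_genA (i u : ZMod n) : lact k (idem k i u) (genA k i u) = genA k i u := by
  rw [genA]
  split_ifs with h
  · have := lact_sumGen k
      (e := fun x : {x : ZMod n × ZMod n // x.2 ≠ x.1 - 1} => idem k (x.1.1 - 1) x.1.2)
      (f := fun x => idem k x.1.1 x.1.2) ⟨(i + 1, u), h⟩ (idem_mul_self k _ _)
    simp only [add_sub_cancel_right] at this
    refine (lact_prod k _ _ _).trans ?_
    rw [map_zero]
    exact Prod.ext this rfl
  · rw [map_zero]

theorem ract_genA (i u : ZMod n) : ract k (idem k (i + 1) u) (genA k i u) = genA k i u := by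
  rw [genA]
  split_ifs with h
  · have := ract_sumGen k
      (e := fun x : {x : ZMod n × ZMod n // x.2 ≠ x.1 - 1} => idem k (x.1.1 - 1) x.1.2)
      (f := fun x => idem k x.1.1 x.1.2) ⟨(i + 1, u), h⟩ (idem_mul_self k _ _)
    refine (ract_prod k _ _ _).trans ?_
    rw [map_zero]
    exact Prod.ext this rfl
  · rw [map_zero]

theorem lact_genB (i u : ZMod n) : lact k (idem k i u) (genB k i u) = genB k i u := by
  rw [genB]
  split_ifs with h
  · have := lact_sumGen k
      (e := fun x : {x : ZMod n × ZMod n // x.2 ≠ x.1} => idem k x.1.1 (x.1.2 - 1))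
      (f := fun x => idem k x.1.1 x.1.2) ⟨(i, u + 1), h⟩ (idem_mul_self k _ _)
    simp only [add_sub_cancel_right] at this
    refine (lact_prod k _ _ _).trans ?_
    rw [map_zero]
    exact Prod.ext rfl this
  · rw [map_zero]

theorem ract_genB (i u : ZMod n) : ract k (idem k i (u + 1)) (genB k i u) = genB k i u := by
  rw [genB]
  split_ifs with h
  · have := ract_sumGen k
      (e := fun x : {x : ZMod n × ZMod n // x.2 ≠ x.1} => idem k x.1.1 (x.1.2 - 1))
      (f := fun x => idem k x.1.1 x.1.2) ⟨(i, u + 1), h⟩ (idem_mul_self k _ _)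
    refine (ract_prod k _ _ _).trans ?_
    rw [map_zero]
    exact Prod.ext rfl this
  · rw [map_zero]

theorem lact_gen₂ (i u : ZMod n) : lact k (idem k i u) (gen₂ k i u) = gen₂ k i u := by
  rw [gen₂]
  split_ifs with h
  · have := lact_sumGen k
      (e := fun x : {x : ZMod n × ZMod n // x.1 ≠ x.2} => idem k (x.1.1 - 1) (x.1.2 - 1))
      (f := fun x => idem k x.1.1 x.1.2) ⟨(i + 1, u + 1), h⟩ (idem_mul_self k _ _)
    simpa only [add_sub_cancel_right] using this
  · rw [map_zero]

theorem ract_gen₂ (i u : ZMod n) :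
    ract k (idem k (i + 1) (u + 1)) (gen₂ k i u) = gen₂ k i u := by
  rw [gen₂]
  split_ifs with h
  · exact ract_sumGen k
      (e := fun x : {x : ZMod n × ZMod n // x.1 ≠ x.2} => idem k (x.1.1 - 1) (x.1.2 - 1))
      (f := fun x => idem k x.1.1 x.1.2) ⟨(i + 1, u + 1), h⟩ (idem_mul_self k _ _)
  · rw [map_zero]

variable {M : Type*} [AddCommGroup M] [Module (EnvelopingAlgebra k (Gam k n)) M]

theorem exists_lift₀ (m : ZMod n → ZMod n → M) (hl : ∀ i u, lact k (idem k i u) (m i u) = m i u)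
    (hr : ∀ i u, ract k (idem k i u) (m i u) = m i u) :
    ∃ φ : R₀ k n →ₗ[EnvelopingAlgebra k (Gam k n)] M, ∀ i u, φ (gen₀ k i u) = m i u := by
  obtain ⟨φ, hφ⟩ := exists_sum_lift k (e := fun x : ZMod n × ZMod n => idem k x.1 x.2)
    (f := fun x => idem k x.1 x.2) (fun x => m x.1 x.2) (fun x => hl x.1 x.2)
    (fun x => hr x.1 x.2)
  exact ⟨φ, fun i u => hφ (i, u)⟩

theorem exists_lift₁ (a b : ZMod n → ZMod n → M)
    (hla : ∀ i u, lact k (idem k i u) (a i u) = a i u)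
    (hra : ∀ i u, ract k (idem k (i + 1) u) (a i u) = a i u)
    (hlb : ∀ i u, lact k (idem k i u) (b i u) = b i u)
    (hrb : ∀ i u, ract k (idem k i (u + 1)) (b i u) = b i u) :
    ∃ φ : R₁ k n →ₗ[EnvelopingAlgebra k (Gam k n)] M,
      (∀ i u, u ≠ i → φ (genA k i u) = a i u) ∧ (∀ i u, u + 1 ≠ i → φ (genB k i u) = b i u) := by
  obtain ⟨φ, hφ⟩ := exists_sum_lift k
    (e := fun x : {x : ZMod n × ZMod n // x.2 ≠ x.1 - 1} => idem k (x.1.1 - 1) x.1.2)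
    (f := fun x => idem k x.1.1 x.1.2) (fun x => a (x.1.1 - 1) x.1.2)
    (fun x => hla _ _) (fun x => by simpa only [sub_add_cancel] using hra (x.1.1 - 1) x.1.2)
  obtain ⟨ψ, hψ⟩ := exists_sum_lift k
    (e := fun x : {x : ZMod n × ZMod n // x.2 ≠ x.1} => idem k x.1.1 (x.1.2 - 1))
    (f := fun x => idem k x.1.1 x.1.2) (fun x => b x.1.1 (x.1.2 - 1))
    (fun x => hlb _ _) (fun x => by simpa only [sub_add_cancel] using hrb x.1.1 (x.1.2 - 1))
  refine ⟨φ.coprod ψ, fun i u h => ?_, fun i u h => ?_⟩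
  · rw [genA, dif_pos (by simpa using h)]
    refine (LinearMap.coprod_apply _ _ _).trans ?_
    rw [map_zero, add_zero]
    refine (hφ _).trans ?_
    simp only [add_sub_cancel_right]
  · rw [genB, dif_pos h]
    refine (LinearMap.coprod_apply _ _ _).trans ?_
    rw [map_zero, zero_add]
    refine (hψ _).trans ?_
    simp only [add_sub_cancel_right]

theorem exists_lift₂ (m : ZMod n → ZMod n → M) (hl : ∀ i u, lact k (idem k i u) (m i u) = m i u)
    (hr : ∀ i u, ract k (idem k (i + 1) (u + 1)) (m i u) = m i u) :
    ∃ φ : R₂ k n →ₗ[EnvelopingAlgebra k (Gam k n)] M,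
      ∀ i u, u ≠ i → φ (gen₂ k i u) = m i u := by
  obtain ⟨φ, hφ⟩ := exists_sum_lift k
    (e := fun x : {x : ZMod n × ZMod n // x.1 ≠ x.2} => idem k (x.1.1 - 1) (x.1.2 - 1))
    (f := fun x => idem k x.1.1 x.1.2) (fun x => m (x.1.1 - 1) (x.1.2 - 1))
    (fun x => hl _ _)
    (fun x => by simpa only [sub_add_cancel] using hr (x.1.1 - 1) (x.1.2 - 1))
  refine ⟨φ, fun i u h => ?_⟩
  rw [gen₂, dif_pos (fun h' => h (add_right_cancel h').symm)]
  refine (hφ _).trans ?_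
  rw [add_sub_cancel_right, add_sub_cancel_right]

theorem exists_liftLeft₀ (D : ZMod n → ZMod n → ℕ → ℕ → M)
    (hl : ∀ i u s t, lact k (idem k i u) (D i u s t) = D i u s t) :
    ∃ φ : R₀ k n →+ M, (∀ (p : Gam k n) m, φ (lact k p m) = lact k p (φ m)) ∧
      ∀ i u s t, Valid i u s t → φ (ract k (word k i u s t) (gen₀ k i u)) = D i u s t := by
  obtain ⟨H, hH, hD⟩ := exists_hom_word k D
  obtain ⟨φ, hφ, hφ'⟩ := exists_sum_liftLeft k
    (e := fun x : ZMod n × ZMod n => idem k x.1 x.2)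
    (f := fun x => idem k x.1 x.2) (fun _ => H) (fun _ => hH)
  refine ⟨φ, hφ, fun i u s t h => (hφ' (i, u) _).trans ?_⟩
  rw [idem_mul_word, hD i u s t h, hl]

/-- This is the shape of the degree-one homotopy: an arrow `b` in front of a word gives a word again
and uses no relation, so its generator is sent to zero; only the generators of the arrows `a`
contribute. -/
theorem exists_liftLeft₁ (E : ZMod n → ZMod n → ℕ → ℕ → M)
    (hl : ∀ i u s t, lact k (idem k i u) (E i u s t) = E i u s t) :
    ∃ φ : R₁ k n →+ M, (∀ (p : Gam k n) m, φ (lact k p m) = lact k p (φ m)) ∧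
      (∀ i u s t, u ≠ i → Valid (i + 1) u s t →
        φ (ract k (word k (i + 1) u s t) (genA k i u)) = E i u s t) ∧
      ∀ i u (q : Gam k n), φ (ract k q (genB k i u)) = 0 := by
  choose H hH hE using fun i : ZMod n => exists_hom_word k fun (_ u : ZMod n) s t => E i u s t
  obtain ⟨φ, hφ, hφ'⟩ := exists_sum_liftLeft k
    (e := fun x : {x : ZMod n × ZMod n // x.2 ≠ x.1 - 1} => idem k (x.1.1 - 1) x.1.2)
    (f := fun x => idem k x.1.1 x.1.2) (fun x => H (x.1.1 - 1)) (fun _ => hH _)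
  refine ⟨φ.comp (AddMonoidHom.fst _ _), fun p m => hφ p m.1, fun i u s t h hv => ?_,
    fun i u q => ?_⟩
  · rw [genA, dif_pos (by simpa using h)]
    refine (hφ' ⟨(i + 1, u), by simpa using h⟩ _).trans ?_
    simp only [idem_mul_word, add_sub_cancel_right, hE i _ u s t hv, hl]
  · rw [genB]
    split_ifs with h
    · refine Eq.trans (congrArg φ ?_) φ.map_zero
      exact map_zero (ract k q)
    · rw [map_zero, map_zero]

end Generators

end TaftAuslander

namespace TaftAuslander

variable (k : Type*) [Field k] {n : ℕ} [NeZero n]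

/-! ### Endpoints, signs, differentials and derivatives of words. -/

section Ends

variable {k} {M : Type*} [AddCommGroup M] [Module (EnvelopingAlgebra k (Gam k n)) M]

theorem lact_ract_fix {e q : Gam k n} {m : M} (h : lact k e m = m) :
    lact k e (ract k q m) = ract k q m := by
  rw [← ract_lact, h]

theorem lact_lact_fix {e p : Gam k n} {m : M} (h : e * p = p) :
    lact k e (lact k p m) = lact k p m := by
  rw [← lact_mul, h]

theorem ract_lact_fix {f p : Gam k n} {m : M} (h : ract k f m = m) :
    ract k f (lact k p m) = lact k p m := by
  rw [ract_lact, h]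

theorem ract_ract_fix {f q : Gam k n} {m : M} (h : q * f = q) :
    ract k f (ract k q m) = ract k q m := by
  rw [← ract_mul, h]

end Ends

section Sign

variable {M N : Type*} [AddCommGroup M] [AddCommGroup N]

/-- Multiplication by `(-1) ^ s`. -/
def signHom (s : ℕ) : M →+ M := (-1 : ℤ) ^ s • AddMonoidHom.id M

theorem signHom_apply (s : ℕ) (m : M) : signHom s m = (-1 : ℤ) ^ s • m := rfl

theorem signHom_zero (m : M) : signHom 0 m = m := by rw [signHom_apply, pow_zero, one_smul]

theorem signHom_succ (s : ℕ) (m : M) : signHom (s + 1) m = -signHom s m := by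
  rw [signHom_apply, signHom_apply, pow_succ, mul_neg_one, neg_smul]

theorem map_signHom (φ : M →+ N) (s : ℕ) (m : M) : φ (signHom s m) = signHom s (φ m) := by
  rw [signHom_apply, signHom_apply, map_zsmul]

end Sign

theorem arrA_mul_word_eq_signHom (hn : 2 ≤ n) {i u : ZMod n} (h : u ≠ i) (s t : ℕ) :
    arrA k i u * word k (i + 1) u s t = signHom s (word k i u s (t + 1)) :=
  arrA_mul_word k hn h s t

theorem ract_signHom {M : Type*} [AddCommGroup M] [Module (EnvelopingAlgebra k (Gam k n)) M]
    (s : ℕ) (x : Gam k n) (m : M) : ract k (signHom s x) m = signHom s (ract k x m) :=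
  map_signHom ((ract k).flip m) s x

theorem exists_epsilon : ∃ ε : R₀ k n →ₗ[EnvelopingAlgebra k (Gam k n)] Gam k n,
    ∀ i u, ε (gen₀ k i u) = idem k i u :=
  exists_lift₀ k (fun i u => idem k i u)
    (fun i u => by rw [lact_self, idem_mul_self]) (fun i u => by rw [ract_self, idem_mul_self])

/-- The formulas need no side condition: at a missing arrow both the generator and the arrow are
zero. -/
theorem exists_d₁ : ∃ d₁ : R₁ k n →ₗ[EnvelopingAlgebra k (Gam k n)] R₀ k n,
    (∀ i u, d₁ (genA k i u) = ract k (arrA k i u) (gen₀ k i u) -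
      lact k (arrA k i u) (gen₀ k (i + 1) u)) ∧
    ∀ i u, d₁ (genB k i u) = ract k (arrB k i u) (gen₀ k i u) -
      lact k (arrB k i u) (gen₀ k i (u + 1)) := by
  obtain ⟨d₁, hA, hB⟩ := exists_lift₁ k (n := n)
    (fun i u => ract k (arrA k i u) (gen₀ k i u) - lact k (arrA k i u) (gen₀ k (i + 1) u))
    (fun i u => ract k (arrB k i u) (gen₀ k i u) - lact k (arrB k i u) (gen₀ k i (u + 1)))
    (fun i u => by
      rw [map_sub, lact_ract_fix (lact_gen₀ k i u), lact_lact_fix (idem_mul_arrA k i u)])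
    (fun i u => by
      rw [map_sub, ract_ract_fix (arrA_mul_idem k i u), ract_lact_fix (ract_gen₀ k _ u)])
    (fun i u => by
      rw [map_sub, lact_ract_fix (lact_gen₀ k i u), lact_lact_fix (idem_mul_arrB k i u)])
    (fun i u => by
      rw [map_sub, ract_ract_fix (arrB_mul_idem k i u), ract_lact_fix (ract_gen₀ k i _)])
  refine ⟨d₁, fun i u => ?_, fun i u => ?_⟩
  · by_cases h : u = i
    · subst h
      simp [genA_self, arrA_self]
    · exact hA i u h
  · by_cases h : u + 1 = i
    · simp [genB_end k h, arrB_end k h]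
    · exact hB i u h

/-- The four terms differentiate the two paths of the mesh. For `u = i` there is no mesh, and the
right-hand side need not vanish, hence the condition. At a boundary mesh the second pair of terms is
zero. -/
theorem exists_d₂ : ∃ d₂ : R₂ k n →ₗ[EnvelopingAlgebra k (Gam k n)] R₁ k n,
    ∀ i u, u ≠ i → d₂ (gen₂ k i u) =
      (ract k (arrB k (i + 1) u) (genA k i u) + lact k (arrA k i u) (genB k (i + 1) u)) +
      (ract k (arrA k i (u + 1)) (genB k i u) + lact k (arrB k i u) (genA k i (u + 1))) := by
  refine exists_lift₂ k (fun i u =>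
      (ract k (arrB k (i + 1) u) (genA k i u) + lact k (arrA k i u) (genB k (i + 1) u)) +
      (ract k (arrA k i (u + 1)) (genB k i u) + lact k (arrB k i u) (genA k i (u + 1))))
    (fun i u => ?_) (fun i u => ?_)
  · rw [map_add, map_add, map_add, lact_ract_fix (lact_genA k i u),
      lact_ract_fix (lact_genB k i u), lact_lact_fix (idem_mul_arrA k i u),
      lact_lact_fix (idem_mul_arrB k i u)]
  · rw [map_add, map_add, map_add, ract_ract_fix (arrB_mul_idem k (i + 1) u),
      ract_ract_fix (arrA_mul_idem k i (u + 1)), ract_lact_fix (ract_genB k (i + 1) u),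
      ract_lact_fix (ract_genA k i (u + 1))]

/-- The derivative of a word: the sum over its arrows of the word with the arrow replaced by the
corresponding generator of `R₁`. -/
def wordDeriv : ZMod n → ZMod n → ℕ → ℕ → R₁ k n
  | _, _, 0, 0 => 0
  | i, u, 0, t + 1 =>
    ract k (word k (i + 1) u 0 t) (genA k i u) + lact k (arrA k i u) (wordDeriv (i + 1) u 0 t)
  | i, u, s + 1, t =>
    ract k (word k i (u + 1) s t) (genB k i u) + lact k (arrB k i u) (wordDeriv i (u + 1) s t)

theorem wordDeriv_zero (i u : ZMod n) : wordDeriv k i u 0 0 = 0 := by rw [wordDeriv]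

theorem wordDeriv_a (i u : ZMod n) (t : ℕ) : wordDeriv k i u 0 (t + 1) =
    ract k (word k (i + 1) u 0 t) (genA k i u) +
      lact k (arrA k i u) (wordDeriv k (i + 1) u 0 t) := by rw [wordDeriv]

theorem wordDeriv_b (i u : ZMod n) (s t : ℕ) : wordDeriv k i u (s + 1) t =
    ract k (word k i (u + 1) s t) (genB k i u) +
      lact k (arrB k i u) (wordDeriv k i (u + 1) s t) := by rw [wordDeriv]

theorem lact_wordDeriv (i u : ZMod n) (s t : ℕ) :
    lact k (idem k i u) (wordDeriv k i u s t) = wordDeriv k i u s t := by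
  cases s with
  | zero =>
    cases t with
    | zero => rw [wordDeriv_zero, map_zero]
    | succ t =>
      rw [wordDeriv_a, map_add, lact_ract_fix (lact_genA k i u),
        lact_lact_fix (idem_mul_arrA k i u)]
  | succ s =>
    rw [wordDeriv_b, map_add, lact_ract_fix (lact_genB k i u),
      lact_lact_fix (idem_mul_arrB k i u)]

/-- Makes the degree-zero homotopy agree with `wordDeriv` on all words, including those that vanish
in `Γ`. -/
theorem wordDeriv_eq_zero {i u : ZMod n} {s t : ℕ} (h : ¬ Valid i u s t) :
    wordDeriv k i u s t = 0 := by
  induction s generalizing u with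
  | zero =>
    induction t generalizing i with
    | zero => exact absurd (valid_zero i u) h
    | succ t ih =>
      rw [wordDeriv_a]
      by_cases hu : u = i
      · subst hu
        simp [arrA_self, genA_self]
      · have h' := mt (valid_a_zero hu t).2 h
        rw [ih h', word_eq_zero k h']
        simp
  | succ s ih =>
    rw [wordDeriv_b]
    by_cases hu : u + 1 = i
    · simp [arrB_end k hu, genB_end k hu]
    · have hv := mt (valid_b hu s t).2 h
      rw [ih hv, word_eq_zero k hv]
      simp

/-- The element of `R₂` that records the mesh relations used to move an arrow `a` past the
arrows `b` of a word. -/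
def meshDeriv : ZMod n → ZMod n → ℕ → ℕ → R₂ k n
  | _, _, 0, _ => 0
  | i, u, s + 1, t =>
    ract k (word k (i + 1) (u + 1) s t) (gen₂ k i u) -
      lact k (arrB k i u) (meshDeriv i (u + 1) s t)

theorem meshDeriv_zero (i u : ZMod n) (t : ℕ) : meshDeriv k i u 0 t = 0 := by rw [meshDeriv]

theorem meshDeriv_succ (i u : ZMod n) (s t : ℕ) : meshDeriv k i u (s + 1) t =
    ract k (word k (i + 1) (u + 1) s t) (gen₂ k i u) -
      lact k (arrB k i u) (meshDeriv k i (u + 1) s t) := by rw [meshDeriv]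

theorem lact_meshDeriv (i u : ZMod n) (s t : ℕ) :
    lact k (idem k i u) (meshDeriv k i u s t) = meshDeriv k i u s t := by
  cases s with
  | zero => rw [meshDeriv_zero, map_zero]
  | succ s =>
    rw [meshDeriv_succ, map_sub, lact_ract_fix (lact_gen₂ k i u),
      lact_lact_fix (idem_mul_arrB k i u)]

/-- The left linear section `x ↦ ∑ x e ⊗ e` of the multiplication map. -/
def unitSection : Gam k n →+ R₀ k n :=
  ∑ v : ZMod n × ZMod n, (lact k).flip (gen₀ k v.1 v.2)

theorem unitSection_apply (x : Gam k n) :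
    unitSection k x = ∑ v : ZMod n × ZMod n, lact k x (gen₀ k v.1 v.2) := by
  simp [unitSection]

theorem unitSection_mul (x y : Gam k n) :
    unitSection k (x * y) = lact k x (unitSection k y) := by
  simp only [unitSection_apply, map_sum, lact_mul]

theorem unitSection_idem (i u : ZMod n) : unitSection k (idem k i u) = gen₀ k i u := by
  rw [unitSection_apply, Finset.sum_eq_single (i, u), lact_gen₀]
  · rintro ⟨i', u'⟩ - h
    rw [← lact_gen₀, ← lact_mul, idem_mul_of_ne k (Ne.symm h), map_zero, AddMonoidHom.zero_apply]
  · simp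

variable {k}

/-! ### The complex, its contracting homotopy and the radical. -/

section Differentials

/-- `ε` is the multiplication map. -/
abbrev IsMulMap (ε : R₀ k n →ₗ[EnvelopingAlgebra k (Gam k n)] Gam k n) : Prop :=
  ∀ i u, ε (gen₀ k i u) = idem k i u

/-- `d₁` sends the generator of an arrow `α` to `e ⊗ α - α ⊗ e`, for the arrows `a`. -/
abbrev IsArrowMapA (d₁ : R₁ k n →ₗ[EnvelopingAlgebra k (Gam k n)] R₀ k n) : Prop :=
  ∀ i u, d₁ (genA k i u) = ract k (arrA k i u) (gen₀ k i u) -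
    lact k (arrA k i u) (gen₀ k (i + 1) u)

/-- `d₁` sends the generator of an arrow `α` to `e ⊗ α - α ⊗ e`, for the arrows `b`. -/
abbrev IsArrowMapB (d₁ : R₁ k n →ₗ[EnvelopingAlgebra k (Gam k n)] R₀ k n) : Prop :=
  ∀ i u, d₁ (genB k i u) = ract k (arrB k i u) (gen₀ k i u) -
    lact k (arrB k i u) (gen₀ k i (u + 1))

/-- `d₂` sends the generator of a mesh to the derivative of the mesh relation. -/
abbrev IsMeshMap (d₂ : R₂ k n →ₗ[EnvelopingAlgebra k (Gam k n)] R₁ k n) : Prop :=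
  ∀ i u, u ≠ i → d₂ (gen₂ k i u) =
    (ract k (arrB k (i + 1) u) (genA k i u) + lact k (arrA k i u) (genB k (i + 1) u)) +
    (ract k (arrA k i (u + 1)) (genB k i u) + lact k (arrB k i u) (genA k i (u + 1)))

variable {ε : R₀ k n →ₗ[EnvelopingAlgebra k (Gam k n)] Gam k n}
  {d₁ : R₁ k n →ₗ[EnvelopingAlgebra k (Gam k n)] R₀ k n}
  {d₂ : R₂ k n →ₗ[EnvelopingAlgebra k (Gam k n)] R₁ k n}

theorem epsilon_unitSection (hε : IsMulMap ε) (x : Gam k n) : ε (unitSection k x) = x := by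
  rw [unitSection_apply, map_sum]
  simp only [map_lact, hε, lact_self]
  rw [← Finset.mul_sum, sum_idem, mul_one]

/-- The sum telescopes: only `e ⊗ w` and `w ⊗ e` survive for the word `w`. -/
theorem d₁_wordDeriv (hdA : IsArrowMapA d₁) (hdB : IsArrowMapB d₁) (i u : ZMod n) (s t : ℕ) : d₁ (wordDeriv k i u s t) =
    ract k (word k i u s t) (gen₀ k i u) - unitSection k (word k i u s t) := by
  induction s generalizing u with
  | zero =>
    induction t generalizing i with
    | zero => rw [wordDeriv_zero, map_zero, word_zero, unitSection_idem, ract_gen₀, sub_self]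
    | succ t ih =>
      rw [wordDeriv_a, map_add, map_ract, map_lact, ih, hdA, map_sub, map_sub, word_a, ract_mul,
        unitSection_mul, ract_lact]
      abel
  | succ s ih =>
    rw [wordDeriv_b, map_add, map_ract, map_lact, ih, hdB, map_sub, map_sub, word_b, ract_mul,
      unitSection_mul, ract_lact]
    abel

/-- The path `a b ⋯ b a ⋯ a` and its normal form agree in `Γ` up to sign, but their derivatives
differ by the boundary of the meshes crossed. The induction on `s` crosses one mesh at a time. -/
theorem d₂_meshDeriv (hd₂ : IsMeshMap d₂) (hn : 2 ≤ n) {i u : ZMod n} (h : u ≠ i) (s t : ℕ) :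
    d₂ (meshDeriv k i u s t) = ract k (word k (i + 1) u s t) (genA k i u) +
      lact k (arrA k i u) (wordDeriv k (i + 1) u s t) -
        signHom s (wordDeriv k i u s (t + 1)) := by
  induction s generalizing u with
  | zero => rw [meshDeriv_zero, map_zero, wordDeriv_a, signHom_zero, sub_self]
  | succ s ih =>
    -- The induction hypothesis is unavailable at `u + 1 = i`, but there the arrow `b` in front is
    -- zero; the same distinction is made in `h2`.
    have h1 : lact k (arrB k i u) (d₂ (meshDeriv k i (u + 1) s t)) =
        lact k (arrB k i u) (ract k (word k (i + 1) (u + 1) s t) (genA k i (u + 1)) +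
          lact k (arrA k i (u + 1)) (wordDeriv k (i + 1) (u + 1) s t) -
            signHom s (wordDeriv k i (u + 1) s (t + 1))) := by
      by_cases h' : u + 1 = i
      · simp [arrB_end k h']
      · rw [ih h']
    have h2 : ract k (arrA k i (u + 1) * word k (i + 1) (u + 1) s t) (genB k i u) =
        signHom s (ract k (word k i (u + 1) s (t + 1)) (genB k i u)) := by
      by_cases h' : u + 1 = i
      · simp [genB_end k h']
      · rw [arrA_mul_word_eq_signHom k hn h', ract_signHom]
    have h3 : lact k (arrA k i u) (lact k (arrB k (i + 1) u)
          (wordDeriv k (i + 1) (u + 1) s t)) =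
        -lact k (arrB k i u) (lact k (arrA k i (u + 1)) (wordDeriv k (i + 1) (u + 1) s t)) := by
      rw [← lact_mul, ← lact_mul, eq_neg_of_add_eq_zero_left (mesh k hn h), map_neg,
        AddMonoidHom.neg_apply]
    rw [meshDeriv_succ, map_sub, map_ract, map_lact, h1, hd₂ i u h, word_b, wordDeriv_b,
      wordDeriv_b]
    simp only [map_add, map_sub, map_signHom, ract_lact, h3]
    rw [← ract_mul, ← ract_mul, h2, signHom_succ, signHom_succ]
    abel

theorem epsilon_d₁ (hε : IsMulMap ε) (hdA : IsArrowMapA d₁) (hdB : IsArrowMapB d₁) (x : R₁ k n) : ε (d₁ x) = 0 := by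
  refine mem_of_gen₁ k (AddMonoidHom.ker (ε.comp d₁).toAddMonoidHom) (fun i u _ p q => ?_)
    (fun i u _ p q => ?_) x
  · change ε (d₁ (lact k p (ract k q (genA k i u)))) = 0
    rw [map_lact, map_ract, hdA, map_lact, map_ract, map_sub, map_ract, map_lact, hε, hε,
      ract_self k (arrA k i u), lact_self k (arrA k i u), idem_mul_arrA, arrA_mul_idem, sub_self,
      map_zero, map_zero]
  · change ε (d₁ (lact k p (ract k q (genB k i u)))) = 0
    rw [map_lact, map_ract, hdB, map_lact, map_ract, map_sub, map_ract, map_lact, hε, hε,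
      ract_self k (arrB k i u), lact_self k (arrB k i u), idem_mul_arrB, arrB_mul_idem, sub_self,
      map_zero, map_zero]

/-- On a mesh relation `r` the mixed terms cancel and leave `e ⊗ r - r ⊗ e`, which is zero because
`r = 0` in `Γ`. -/
theorem d₁_d₂ (hdA : IsArrowMapA d₁) (hdB : IsArrowMapB d₁) (hd₂ : IsMeshMap d₂) (hn : 2 ≤ n) (x : R₂ k n) : d₁ (d₂ x) = 0 := by
  refine mem_of_gen₂ k (AddMonoidHom.ker (d₁.comp d₂).toAddMonoidHom) (fun i u h p q => ?_) x
  change d₁ (d₂ (lact k p (ract k q (gen₂ k i u)))) = 0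
  have key : d₁ (d₂ (gen₂ k i u)) = 0 := by
    have h1 : ract k (arrA k i u * arrB k (i + 1) u) (gen₀ k i u) =
        -ract k (arrB k i u * arrA k i (u + 1)) (gen₀ k i u) := by
      rw [eq_neg_of_add_eq_zero_left (mesh k hn h), map_neg, AddMonoidHom.neg_apply]
    have h2 : lact k (arrA k i u * arrB k (i + 1) u) (gen₀ k (i + 1) (u + 1)) =
        -lact k (arrB k i u * arrA k i (u + 1)) (gen₀ k (i + 1) (u + 1)) := by
      rw [eq_neg_of_add_eq_zero_left (mesh k hn h), map_neg, AddMonoidHom.neg_apply]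
    rw [hd₂ i u h]
    simp only [map_add, map_ract, map_lact, hdA, hdB, map_sub, ← ract_mul, ← lact_mul, h1, h2,
      ract_lact]
    abel
  rw [map_lact, map_ract, map_lact, map_ract, key, map_zero, map_zero]

/-- The contracting homotopy of the complex `R₂ → R₁ → R₀ → Γ`. -/
theorem exists_homotopy (hε : IsMulMap ε) (hdA : IsArrowMapA d₁) (hdB : IsArrowMapB d₁) (hd₂ : IsMeshMap d₂) (hn : 2 ≤ n) : ∃ (h₀ : R₀ k n →+ R₁ k n) (h₁ : R₁ k n →+ R₂ k n),
    (∀ x, d₁ (h₀ x) + unitSection k (ε x) = x) ∧ (∀ x, d₂ (h₁ x) + h₀ (d₁ x) = x) ∧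
    ∀ x, h₁ (d₂ x) = x := by
  obtain ⟨h₀, hl₀, hw₀⟩ := exists_liftLeft₀ k (wordDeriv k (n := n)) (lact_wordDeriv k)
  obtain ⟨h₁, hl₁, hA₁, hB₁⟩ := exists_liftLeft₁ k (meshDeriv k (n := n)) (lact_meshDeriv k)
  have hw : ∀ i u s t, h₀ (ract k (word k i u s t) (gen₀ k i u)) = wordDeriv k i u s t := by
    intro i u s t
    by_cases hv : Valid i u s t
    · exact hw₀ i u s t hv
    · rw [word_eq_zero k hv, wordDeriv_eq_zero k hv]
      simp
  refine ⟨h₀, h₁, fun x => ?_, fun x => ?_, fun x => ?_⟩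
  · let φ : R₀ k n →+ R₀ k n :=
      d₁.toAddMonoidHom.comp h₀ + (unitSection k).comp ε.toAddMonoidHom
    have hφ : ∀ x, φ x = d₁ (h₀ x) + unitSection k (ε x) := fun _ => rfl
    refine mem_of_gen₀ k (AddMonoidHom.eqLocus φ (AddMonoidHom.id _)) (fun i u p q => ?_) x
    refine eq_on_of_word k hn (fun p m => ?_) (fun p m => rfl) (ract_gen₀ k i u)
      (fun s t _ => ?_) p q
    · rw [hφ, hφ, hl₀, map_lact, map_lact, lact_self, unitSection_mul, map_add]
    · rw [hφ, hw, d₁_wordDeriv hdA hdB, map_ract, hε, ract_self, idem_mul_word, sub_add_cancel]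
      rfl
  · let φ : R₁ k n →+ R₁ k n :=
      d₂.toAddMonoidHom.comp h₁ + h₀.comp d₁.toAddMonoidHom
    have hφ : ∀ x, φ x = d₂ (h₁ x) + h₀ (d₁ x) := fun _ => rfl
    have hφl : ∀ (p : Gam k n) m, φ (lact k p m) = lact k p (φ m) := by
      intro p m
      rw [hφ, hφ, hl₁, map_lact, map_lact, hl₀, map_add]
    refine mem_of_gen₁ k (AddMonoidHom.eqLocus φ (AddMonoidHom.id _)) (fun i u h p q => ?_)
      (fun i u h p q => ?_) x
    · refine eq_on_of_word k hn hφl (fun p m => rfl) (ract_genA k i u) (fun s t hv => ?_) p q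
      -- The term `h₀ (d₁ x)` yields the signed derivative of the normal form minus `a` times the
      -- derivative of the word, which is what `d₂_meshDeriv` has in excess.
      rw [hφ, hA₁ i u s t h hv, d₂_meshDeriv hd₂ hn h, map_ract, hdA, map_sub, ← ract_mul,
        arrA_mul_word_eq_signHom k hn h, ract_signHom, map_sub, map_signHom, hw,
        ract_lact, hl₀, hw, AddMonoidHom.id_apply]
      abel
    · refine eq_on_of_word k hn hφl (fun p m => rfl) (ract_genB k i u) (fun s t _ => ?_) p q
      rw [hφ, hB₁, map_zero, zero_add, map_ract, hdB, map_sub, ← ract_mul, ← word_b, map_sub, hw,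
        ract_lact, hl₀, hw, wordDeriv_b, AddMonoidHom.id_apply, add_sub_cancel_right]
  · let φ : R₂ k n →+ R₂ k n := h₁.comp d₂.toAddMonoidHom
    have hφ : ∀ x, φ x = h₁ (d₂ x) := fun _ => rfl
    refine mem_of_gen₂ k (AddMonoidHom.eqLocus φ (AddMonoidHom.id _)) (fun i u h p q => ?_) x
    refine eq_on_of_word k hn (fun p m => ?_) (fun p m => rfl) (ract_gen₂ k i u)
      (fun s t hv => ?_) p q
    · rw [hφ, hφ, map_lact, hl₁]
    -- Of the four terms of `d₂`, those with generators of arrows `b` die under `h₁`. The leading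
    -- one gives `meshDeriv k i u (s + 1) t`, and this one cancels the correction in its recursion,
    -- leaving the original element.
    · have h1 : lact k (arrB k i u) (h₁ (ract k (word k (i + 1) (u + 1) s t)
          (genA k i (u + 1)))) = lact k (arrB k i u) (meshDeriv k i (u + 1) s t) := by
        by_cases h' : u + 1 = i
        · simp [arrB_end k h']
        · rw [hA₁ i (u + 1) s t h' hv]
      have h2 : d₂ (ract k (word k (i + 1) (u + 1) s t) (gen₂ k i u)) =
          (ract k (word k (i + 1) u (s + 1) t) (genA k i u) +
            lact k (arrA k i u) (ract k (word k (i + 1) (u + 1) s t) (genB k (i + 1) u))) +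
          (ract k (arrA k i (u + 1) * word k (i + 1) (u + 1) s t) (genB k i u) +
            lact k (arrB k i u) (ract k (word k (i + 1) (u + 1) s t) (genA k i (u + 1)))) := by
        rw [map_ract, hd₂ i u h]
        simp only [map_add, ract_lact, ← ract_mul, ← word_b]
      have h3 : h₁ (lact k (arrA k i u) (ract k (word k (i + 1) (u + 1) s t)
          (genB k (i + 1) u))) = 0 :=
        (hl₁ _ _).trans ((congrArg _ (hB₁ _ _ _)).trans (map_zero _))
      have h4 := hA₁ i u (s + 1) t h ((valid_ab h s t).2 hv)
      have h5 := hB₁ i u (arrA k i (u + 1) * word k (i + 1) (u + 1) s t)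
      have h6 := (hl₁ (arrB k i u) (ract k (word k (i + 1) (u + 1) s t)
        (genA k i (u + 1)))).trans h1
      have aux : ∀ x y : R₂ k n, x - y + 0 + (0 + y) = x := fun x y => by abel
      refine (hφ _).trans ((congrArg h₁ h2).trans ?_)
      refine ((h₁.map_add _ _).trans (congrArg₂ (· + ·)
        ((h₁.map_add _ _).trans (congrArg₂ (· + ·) h4 h3))
        ((h₁.map_add _ _).trans (congrArg₂ (· + ·) h5 h6)))).trans ?_
      rw [meshDeriv_succ]
      exact aux _ _

/-- Every term of `d₁` on a generator carries an arrow, which has length one. -/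
theorem d₁_mem_radGen (hdA : IsArrowMapA d₁) (hdB : IsArrowMapB d₁) (hn : 2 ≤ n) (x : R₁ k n) :
    d₁ x ∈ radGen k n (fun v : ZMod n × ZMod n => gen₀ k v.1 v.2) := by
  refine mem_of_gen₁ k ((radGen k n (fun v : ZMod n × ZMod n => gen₀ k v.1 v.2)).comap d₁.toAddMonoidHom) (fun i u _ p q => ?_)
    (fun i u _ p q => ?_) x
  · change d₁ (lact k p (ract k q (genA k i u))) ∈
      radGen k n (fun v : ZMod n × ZMod n => gen₀ k v.1 v.2)
    rw [map_lact, map_ract, hdA]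
    exact lact_ract_mem_radGen k hn p q (sub_mem
      (ract_mem_radGen k (g := fun v : ZMod n × ZMod n => gen₀ k v.1 v.2) hn
        (arrA_mem k i u) (i, u))
      (lact_mem_radGen k (g := fun v : ZMod n × ZMod n => gen₀ k v.1 v.2) hn
        (arrA_mem k i u) (i + 1, u)))
  · change d₁ (lact k p (ract k q (genB k i u))) ∈
      radGen k n (fun v : ZMod n × ZMod n => gen₀ k v.1 v.2)
    rw [map_lact, map_ract, hdB]
    exact lact_ract_mem_radGen k hn p q (sub_mem
      (ract_mem_radGen k (g := fun v : ZMod n × ZMod n => gen₀ k v.1 v.2) hn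
        (arrB_mem k i u) (i, u))
      (lact_mem_radGen k (g := fun v : ZMod n × ZMod n => gen₀ k v.1 v.2) hn
        (arrB_mem k i u) (i, u + 1)))

variable (k n) in
/-- The generators of `R₁`. -/
def gen₁ : (ZMod n × ZMod n) ⊕ (ZMod n × ZMod n) → R₁ k n :=
  Sum.elim (fun v => genA k v.1 v.2) (fun v => genB k v.1 v.2)

theorem d₂_mem_radGen (hd₂ : IsMeshMap d₂) (hn : 2 ≤ n) (x : R₂ k n) : d₂ x ∈ radGen k n (gen₁ k n) := by
  refine mem_of_gen₂ k ((radGen k n (gen₁ k n)).comap d₂.toAddMonoidHom) (fun i u h p q => ?_) x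
  change d₂ (lact k p (ract k q (gen₂ k i u))) ∈ radGen k n (gen₁ k n)
  rw [map_lact, map_ract, hd₂ i u h]
  exact lact_ract_mem_radGen k hn p q (add_mem
    (add_mem (ract_mem_radGen k (g := gen₁ k n) hn (arrB_mem k _ _) (Sum.inl (i, u)))
      (lact_mem_radGen k (g := gen₁ k n) hn (arrA_mem k _ _) (Sum.inr (i + 1, u))))
    (add_mem (ract_mem_radGen k (g := gen₁ k n) hn (arrA_mem k _ _) (Sum.inr (i, u)))
      (lact_mem_radGen k (g := gen₁ k n) hn (arrB_mem k _ _) (Sum.inl (i, u + 1)))))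

end Differentials

/-! ### Projectivity of the terms, nonvanishing of `R₂`, and the theorem. -/

theorem projective_R₀ : Module.Projective (EnvelopingAlgebra k (Gam k n)) (R₀ k n) :=
  sum_projective (fun _ => idem_mul_self k _ _) (fun _ => idem_mul_self k _ _)

theorem projective_R₁ : Module.Projective (EnvelopingAlgebra k (Gam k n)) (R₁ k n) :=
  have := sum_projective (k := k)
    (e := fun x : {x : ZMod n × ZMod n // x.2 ≠ x.1 - 1} => idem k (x.1.1 - 1) x.1.2)
    (f := fun x => idem k x.1.1 x.1.2) (fun _ => idem_mul_self k _ _)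
    (fun _ => idem_mul_self k _ _)
  have := sum_projective (k := k)
    (e := fun x : {x : ZMod n × ZMod n // x.2 ≠ x.1} => idem k x.1.1 (x.1.2 - 1))
    (f := fun x => idem k x.1.1 x.1.2) (fun _ => idem_mul_self k _ _)
    (fun _ => idem_mul_self k _ _)
  inferInstance

theorem projective_R₂ : Module.Projective (EnvelopingAlgebra k (Gam k n)) (R₂ k n) :=
  sum_projective (fun _ => idem_mul_self k _ _) (fun _ => idem_mul_self k _ _)

theorem nontrivial_R₂ (hn : 2 ≤ n) : Nontrivial (R₂ k n) := by
  have : Fact (1 < n) := ⟨hn⟩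
  have h1 : (0 + 1 : ZMod n) ≠ 1 + 1 := fun h => zero_ne_one (add_right_cancel h)
  refine ⟨gen₂ k 0 1, 0, fun h => ?_⟩
  rw [gen₂, dif_pos h1] at h
  exact sumGen_ne_zero k
    (fun x : {x : ZMod n × ZMod n // x.1 ≠ x.2} => idem k (x.1.1 - 1) (x.1.2 - 1))
    (fun x => idem k x.1.1 x.1.2) ⟨(0 + 1, 1 + 1), h1⟩ (idem_ne_zero k _ _)
    (idem_ne_zero k _ _) h

end TaftAuslander

theorem mainTheorem2 (k : Type*) [Field k] [IsAlgClosed k] (n : ℕ) [NeZero n] (hn : 2 ≤ n) :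
    Nontrivial (TaftAuslander.R₂ k n) ∧
    ∃ (d₂ : TaftAuslander.R₂ k n →ₗ[EnvelopingAlgebra k (TaftAuslander.Gam k n)]
          TaftAuslander.R₁ k n)
      (d₁ : TaftAuslander.R₁ k n →ₗ[EnvelopingAlgebra k (TaftAuslander.Gam k n)]
          TaftAuslander.R₀ k n)
      (ε : TaftAuslander.R₀ k n →ₗ[EnvelopingAlgebra k (TaftAuslander.Gam k n)]
          TaftAuslander.Gam k n),
      IsMinimalProjectiveResolution d₂ d₁ ε := by
  open TaftAuslander in
  obtain ⟨ε, hε⟩ := exists_epsilon k (n := n)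
  obtain ⟨d₁, hdA, hdB⟩ := exists_d₁ k (n := n)
  obtain ⟨d₂, hd₂⟩ := exists_d₂ k (n := n)
  obtain ⟨h₀, h₁, e₀, e₁, e₂⟩ := exists_homotopy hε hdA hdB hd₂ hn
  have ex₁ : Function.Exact d₂ d₁ := fun x =>
    ⟨fun h => ⟨h₁ x, by simpa [h] using e₁ x⟩, by
      rintro ⟨y, rfl⟩
      exact d₁_d₂ hdA hdB hd₂ hn y⟩
  have ex₀ : Function.Exact d₁ ε := fun x =>
    ⟨fun h => ⟨h₀ x, by simpa [h] using e₀ x⟩, by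
      rintro ⟨y, rfl⟩
      exact epsilon_d₁ hε hdA hdB y⟩
  have inj : Function.Injective d₂ := Function.LeftInverse.injective e₂
  refine ⟨nontrivial_R₂ hn, d₂, d₁, ε, projective_R₀, projective_R₁, projective_R₂, inj, ex₁, ex₀,
    fun x => ⟨_, epsilon_unitSection hε x⟩, ?_, ?_, ?_⟩
  · refine isSuperfluous_of_le_radGen k hn
      (g := fun v : ZMod n × ZMod n => gen₀ k v.1 v.2)
      (fun S hS => mem_of_gen₀ k S fun i u => hS (i, u)) (fun m hm => ?_)
    obtain ⟨y, rfl⟩ := (ex₀ m).1 hm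
    exact d₁_mem_radGen hdA hdB hn y
  · refine isSuperfluous_of_le_radGen k hn (g := gen₁ k n)
      (fun S hS => mem_of_gen₁ k S (fun i u _ => hS (Sum.inl (i, u)))
        fun i u _ => hS (Sum.inr (i, u))) (fun m hm => ?_)
    obtain ⟨y, rfl⟩ := (ex₁ m).1 hm
    exact d₂_mem_radGen hd₂ hn y
  -- The last kernel is zero because `d₂` is injective, so it is trivially superfluous.
  · intro L hL
    rwa [LinearMap.ker_eq_bot.2 inj, bot_sup_eq] at hL

end
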